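/- Let $d\ge 2$ and let $P$ be a probability law on $\mathbb{R}^d$ with mean zero and $\|x\|_2\le r$ almost surely, where $r\ge 1$. Let $\Sigma=\mathbb{E}[xx^{T}]$ have eigenvalues $\lambda_1>\lambda_2\ge\dots\ge\lambda_d$, let $q^*$ be a unit eigenvector for $\lambda_1$, and put $\sigma^2=\mathbb{E}\|xx^T-\Sigma\|_F^2$. Let $\delta\in(0,1)$, $c_0>2$, $c=c_0/(2(\lambda_1-\lambda_2))$, and choose $$L_1'\ge \frac{64\,e\,d\,r^4\max(1,c^2)}{\delta^2}\ln\frac4\delta,\qquad L_2'\ge\frac{512\,e^2d^2\max(1,c^2)}{\delta^4}\ln\frac4\delta .$$ Let $v_0$ be uniform on the unit sphere of $\mathbb{R}^d$ and, independently of it, let a stream of i.i.d. samples with law $P$ arrive. Let $N,b\ge1$ and $\mu\ge 0$ be integers and $B=bN$. In each iteration of DMK (the distributed mini-batch Krasulina method) $B+\mu$ new samples arrive, of which $\mu$, at positions fixed independently of the data, are discarded; the other $B$ are split into $N$ batches $\{x_{i,j,t}\}_{j=1}^{b}$, and with $A_t=\frac1B\sum_{i=1}^N\sum_{j=1}^b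 x_{i,j,t}x_{i,j,t}^T$ the estimate is updated to $$v_t=v_{t-1}+\gamma_t\Big(A_tv_{t-1}-\frac{v_{t-1}^TA_tv_{t-1}}{\|v_{t-1}\|_2^2}\,v_{t-1}\Big),\qquad \gamma_t=\frac{c}{L+t},\quad L=L_1'+\sigma_B^2L_2',\quad \sigma_B^2=\mathbb{E}\|A_t-\Sigma\|_F^2 .$$ Let $\Psi_t=1-(v_t^Tq^*)^2/\|v_t\|_2^2$ and $\mathcal F_t=\sigma(v_0,A_1,\dots,A_t)$. Put $$C_1=\frac12\Big(\frac{4ed}{\delta^2}\Big)^{5/(2\ln 2)}e^{2c^2\lambda_1^2/L},\qquad C_2=\frac{8c^2e^{(c_0+2c^2\lambda_1^2)/L}}{c_0-2}.$$ Then there are $J\ge0$, integers $0=t_0<t_1<\dots<t_J$ and reals $0<\epsilon_0<\dots<\epsilon_J$ such that the nested events $$\Omega_t'=\Big\{\sup_{t_j\le l<t}\Psi_l\le 1-\epsilon_j\ \text{ for all } 0\le j\le J\Big\},\qquad \Omega'_1\supseteq\Omega'_2\supseteq\cdots,\qquad \Omega_t'\in\mathcal F_{t-1}\ (t\ge1),$$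 satisfy $\mathbb{P}\big(\bigcap_{t>0}\Omega_t'\big)\ge 1-\delta$ and, for every number $T\ge B+\mu$ of samples, with $T_B^\mu=\lfloor T/(B+\mu)\rfloor$ iterations, $$\mathbb{E}\big[\Psi_{T_B^\mu}\,\big|\,\Omega'_{T_B^\mu}\big]\le c_0C_1\Big(\frac{(B+\mu)L_1'}{T}\Big)^{c_0/2}+c_0C_1\Big(\frac{(B+\mu)\sigma^2L_2'}{BT}\Big)^{c_0/2}+\frac{C_2\sigma^2(B+\mu)}{BT}.$$ Moreover, this error is $O(1/T)$ as long as $\mu=O(B)$ and $B+\mu\le T^{1-2/c_0}$: for every $\kappa$ there is a constant $K_\kappa$, depending on neither $N$, $b$, $\mu$ nor $T$, such that if $\mu\le\kappa B$ and $B+\mu\le T^{1-2/c_0}$, then $\mathbb{E}\big[\Psi_{T_B^\mu}\,\big|\,\Omega'_{T_B^\mu}\big]\le K_\kappa/T$. -/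

import Mathlib

open MeasureTheory ProbabilityTheory

universe u

noncomputable section

/-- The ambient space `ℝ^d` with its Euclidean norm. -/
abbrev Vec (d : ℕ) : Type := EuclideanSpace ℝ (Fin d)

/-- The rank-one matrix `x xᵀ`. -/
def outer {d : ℕ} (x : Vec d) : Matrix (Fin d) (Fin d) ℝ :=
  Matrix.of fun i j => x i * x j

/-- The squared Frobenius norm of a matrix. -/
def frobSq {d : ℕ} (M : Matrix (Fin d) (Fin d) ℝ) : ℝ := ∑ i, ∑ j, (M i j) ^ 2

/-- The covariance matrix `Σ = E[x xᵀ]` of a (zero-mean) law `P` on `ℝ^d`. -/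
def covMat {d : ℕ} (P : Measure (Vec d)) : Matrix (Fin d) (Fin d) ℝ :=
  Matrix.of fun i j => ∫ x, outer x i j ∂P

theorem covMat_isHermitian {d : ℕ} (P : Measure (Vec d)) : (covMat P).IsHermitian := by
  ext i j
  simp [covMat, outer, Matrix.conjTranspose_apply, mul_comm]

/-- The eigenvalues of the covariance matrix with multiplicity, in decreasing order:
`covEig P 0 ≥ covEig P 1 ≥ …`. -/
def covEig {d : ℕ} (P : Measure (Vec d)) (i : Fin d) : ℝ :=
  (covMat_isHermitian P).eigenvalues₀ (Fin.cast (Fintype.card_fin d).symm i)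

/-- `λ₁(Σ)`, the largest eigenvalue. -/
def topEig {d : ℕ} (hd : 2 ≤ d) (P : Measure (Vec d)) : ℝ := covEig P ⟨0, by omega⟩

/-- `λ₂(Σ)`, the second largest eigenvalue (with multiplicity). -/
def secondEig {d : ℕ} (hd : 2 ≤ d) (P : Measure (Vec d)) : ℝ := covEig P ⟨1, by omega⟩

/-- `σ² = E ‖x xᵀ - Σ‖_F²`. -/
def sampleVar {d : ℕ} (P : Measure (Vec d)) : ℝ :=
  ∫ x, frobSq (outer x - covMat P) ∂P

/-- The sample covariance `(1/B) ∑ᵢ ∑ⱼ x_{i,j} x_{i,j}ᵀ` of a mini-batch of `B = N * b` samples,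
`b` at each of the `N` processors. -/
def batchCov {d N b : ℕ} (y : Fin N → Fin b → Vec d) : Matrix (Fin d) (Fin d) ℝ :=
  (1 / ((N * b : ℕ) : ℝ)) • ∑ i, ∑ j, outer (y i j)

/-- `σ_B² = E ‖(1/B) ∑ᵢ ∑ⱼ x_{i,j} x_{i,j}ᵀ - Σ‖_F²`, for `B = N * b` independent samples. -/
def batchVar {d : ℕ} (P : Measure (Vec d)) (N b : ℕ) : ℝ :=
  ∫ y : Fin N × Fin b → Vec d,
    frobSq (batchCov (fun i j => y (i, j)) - covMat P) ∂(Measure.pi fun _ => P)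

/-- The direction `x xᵀ v - (vᵀ x xᵀ v / ‖v‖²) v` that one sample contributes. -/
def krasulinaDir {d : ℕ} (x v : Vec d) : Vec d :=
  inner ℝ x v • x - ((inner ℝ x v) ^ 2 / ‖v‖ ^ 2) • v

/-- The iterates of the distributed mini-batch Krasulina method with step sizes `γ 1, γ 2, …`,
started at `v₀`. The mini-batch processed in iteration `t + 1` is `y t`, and `y t i j` is the
`j`-th sample of processor `i` in that iteration. -/
def dmk {d N b : ℕ} (γ : ℕ → ℝ) (v₀ : Vec d) (y : ℕ → Fin N → Fin b → Vec d) : ℕ → Vec d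
  | 0 => v₀
  | t + 1 =>
    dmk γ v₀ y t + γ (t + 1) •
      ((1 / ((N * b : ℕ) : ℝ)) • ∑ i, ∑ j, krasulinaDir (y t i j) (dmk γ v₀ y t))

/-- The potential `1 - (vᵀ q)² / ‖v‖²` of an estimate `v`. -/
def potential {d : ℕ} (q v : Vec d) : ℝ := 1 - (inner ℝ v q) ^ 2 / ‖v‖ ^ 2

/-- The uniform probability measure on the unit sphere, as a measure on `ℝ^d`. -/
def sphereUniform (d : ℕ) : Measure (Vec d) :=
  (((volume : Measure (Vec d)).toSphere Set.univ)⁻¹ • (volume : Measure (Vec d)).toSphere).map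
    Subtype.val

/-- The random input: `v₀` is uniform on the unit sphere, the data stream `x 0, x 1, …`
(`x n` is the sample that arrives at time `n + 1`) is i.i.d. with law `P`, and `v₀` is independent
of the stream. -/
structure IsRandomInput {d : ℕ} (P : Measure (Vec d)) {Ω : Type*} [MeasurableSpace Ω]
    (Pr : Measure Ω) (v₀ : Ω → Vec d) (x : ℕ → Ω → Vec d) : Prop where
  measurable_init : Measurable v₀
  measurable_sample : ∀ n, Measurable (x n)
  law_init : Pr.map v₀ = sphereUniform d
  law_sample : ∀ n, Pr.map (x n) = P
  indep_samples : iIndepFun x Pr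
  indep_init : IndepFun v₀ (fun ω n => x n ω) Pr

/-- A splitter that discards `μ` samples per iteration: of the `N * b + μ` samples that arrive in
each round, `N * b` distinct ones are handed to the processors. `sel t i j` is the position in the
stream of the `j`-th sample that processor `i` gets in round `t + 1`. -/
structure IsSplitter (N b μ : ℕ) (sel : ℕ → Fin N → Fin b → ℕ) : Prop where
  lower : ∀ t i j, t * (N * b + μ) ≤ sel t i j
  upper : ∀ t i j, sel t i j < (t + 1) * (N * b + μ)
  injective : ∀ t, Function.Injective fun p : Fin N × Fin b => sel t p.1 p.2

/-- The mini-batches that a splitter makes of the stream. -/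
def batches {d N b : ℕ} {Ω : Type*} (x : ℕ → Ω → Vec d) (sel : ℕ → Fin N → Fin b → ℕ) (ω : Ω) :
    ℕ → Fin N → Fin b → Vec d :=
  fun t i j => x (sel t i j) ω

/-- The random potential `Ψ_t` of the method run on the random input. -/
def Psi {d N b : ℕ} {Ω : Type*} (q : Vec d) (γ : ℕ → ℝ) (v₀ : Ω → Vec d) (x : ℕ → Ω → Vec d)
    (sel : ℕ → Fin N → Fin b → ℕ) (t : ℕ) (ω : Ω) : ℝ :=
  potential q (dmk γ (v₀ ω) (batches x sel ω) t)

/-- The `σ`-algebra `F_t = σ(v₀, A₁, …, A_t)`, where `A_{s+1}` is the sample covariance of the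
mini-batch processed in iteration `s + 1`. -/
@[reducible] def sigmaAlg {d N b : ℕ} {Ω : Type*} (v₀ : Ω → Vec d) (x : ℕ → Ω → Vec d)
    (sel : ℕ → Fin N → Fin b → ℕ) (t : ℕ) : MeasurableSpace Ω :=
  MeasurableSpace.comap v₀ inferInstance ⊔
    ⨆ s : Fin t, MeasurableSpace.comap
      (fun ω (i j : Fin d) => batchCov (batches x sel ω s) i j) MeasurableSpace.pi

/-- A schedule of pairs `(t_0, ε_0), …, (t_J, ε_J)` with `0 = t_0 < t_1 < … < t_J` and
`0 < ε_0 < ε_1 < … < ε_J`. -/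
structure IsSchedule {J : ℕ} (τ : Fin (J + 1) → ℕ) (ε : Fin (J + 1) → ℝ) : Prop where
  start : τ 0 = 0
  times : StrictMono τ
  pos : 0 < ε 0
  levels : StrictMono ε

/-- The event `Ω'_t` that `sup_{t_j ≤ l < t} Ψ_l ≤ 1 - ε_j` for every `j`. -/
def nestedSpace {Ω : Type*} (Ψ : ℕ → Ω → ℝ) {J : ℕ} (τ : Fin (J + 1) → ℕ) (ε : Fin (J + 1) → ℝ)
    (t : ℕ) : Set Ω :=
  {ω | ∀ j, ∀ l, τ j ≤ l → l < t → Ψ l ω ≤ 1 - ε j}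

/-- The lower bound `L₁ = (64 e d r⁴ max(1, c²) / δ²) ln(4/δ)`. -/
def boundL₁ (d : ℕ) (r c δ : ℝ) : ℝ :=
  64 * Real.exp 1 * d * r ^ 4 * max 1 (c ^ 2) / δ ^ 2 * Real.log (4 / δ)

/-- The ratio `L₂ / σ_B² = (512 e² d² max(1, c²) / δ⁴) ln(4/δ)`, which does not depend on `B`. -/
def boundL₂ (d : ℕ) (c δ : ℝ) : ℝ :=
  512 * Real.exp 1 ^ 2 * (d : ℝ) ^ 2 * max 1 (c ^ 2) / δ ^ 4 * Real.log (4 / δ)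

/-- `C₁ = (1/2) (4 e d / δ²)^{5 / (2 ln 2)} e^{2 c² λ₁² / L}`. -/
def constC₁ (d : ℕ) (δ c l₁ L : ℝ) : ℝ :=
  1 / 2 * (4 * Real.exp 1 * d / δ ^ 2) ^ (5 / (2 * Real.log 2)) *
    Real.exp (2 * c ^ 2 * l₁ ^ 2 / L)

/-- `C₂ = 8 c² e^{(c₀ + 2 c² λ₁²) / L} / (c₀ - 2)`. -/
def constC₂ (c₀ c l₁ L : ℝ) : ℝ :=
  8 * c ^ 2 * Real.exp ((c₀ + 2 * c ^ 2 * l₁ ^ 2) / L) / (c₀ - 2)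

end

/-! The quantity to follow is not `Ψ = sin²` but `tan² = sec² - 1` of the angle between the estimate
and `q`. The Krasulina increment is orthogonal to the current vector, so from a unit vector one step
multiplies `sec²` by a factor `(1 + γ²‖·‖²) / (1 + γη)²`. When `|γη| ≤ 1/10`, expanding it
(`secSq_krasulinaStep_le`) gives a contraction of `tan²` by `1 - 2γ(λ₁ - λ₂) + 6γ²λ₁²`, a term
linear in the error `A - Σ`, which has mean zero, and a quadratic term of mean order `γ²σ_B²`,
amplified by powers of `sec²`. As long as `Ψ ≤ 1 - ε`, `sec² ≤ 1/ε`; this limits the amplification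
and, the samples being bounded, also guarantees `|γη| ≤ 1/10`. Independence of each batch from the
past turns this into a recursion for `E[tan²; past event]` (`lintegral_tanSq_succ_le`).

A single level is enough: `J = 0`, `t₀ = 0`, `ε = δ³ / (128 e d)`. A Gaussian estimate for cones
(`sphereUniform_cone_le`) gives `Ψ₀ ≤ 1 - η`, `η = δ² / (16 e d)`, outside probability `δ/4`. From
there `1 + tan²`, stopped on leaving the good event, is a supermartingale up to weights that never
exceed `1.43`, and leaving means `1 + tan² ≥ 1/ε`. So the exit probability is at most `1.43 ε/η ≤
δ/4` (`measure_diff_goodEvent_le`). The lower bounds on `L₁'` and `L₂'` are what keeps the weights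
bounded (`step_constants`).

On the good event, with `2γ_t(λ₁ - λ₂) = c₀/(L + t)`, the recursion has an explicit supersolution
(`explicit_recursion`): a transient `(1/ε)((L+1)/(L+t+1))^{c₀}` plus noise of order `σ_B²/(L+t)`.
The transient decays with exponent `c₀`, twice the exponent claimed, and this surplus is traded by
AM-GM and convexity for a split along `L = L₁' + σ_B²L₂'` (`transient_le`). Finally `σ_B² = σ²/B`
(`batchVar_eq`), and conditioning on an event of probability at least `1/2` costs a factor `2`. -/

/-! ### One deterministic step: the change of `tan²`. -/

section Geometry

variable {E : Type*} [NormedAddCommGroup E] [InnerProductSpace ℝ E]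

/-- The component of `w` orthogonal to `u`, for a unit vector `u`. -/
theorem norm_sq_sub_inner_smul {u : E} (hu : ‖u‖ = 1) (w : E) :
    ‖w - (inner ℝ u w : ℝ) • u‖ ^ 2 = ‖w‖ ^ 2 - (inner ℝ u w : ℝ) ^ 2 := by
  rw [norm_sub_sq_real, norm_smul, mul_pow, hu, inner_smul_right, real_inner_comm u w]
  simp only [Real.norm_eq_abs, sq_abs]
  ring

theorem inner_sub_inner_smul_self {u : E} (hu : ‖u‖ = 1) (w : E) :
    inner ℝ u (w - (inner ℝ u w : ℝ) • u) = 0 := by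
  rw [inner_sub_right, inner_smul_right, real_inner_self_eq_norm_sq, hu]
  ring

/-- The inverse squared cosine of the angle between `v` and `q`. -/
noncomputable def secSq (q v : E) : ℝ := ‖v‖ ^ 2 / (inner ℝ v q : ℝ) ^ 2

/-- With `krasulinaStep_smul`, this allows normalizing the current estimate to a unit vector. -/
theorem secSq_smul (q v : E) {a : ℝ} (ha : a ≠ 0) : secSq q (a • v) = secSq q v := by
  unfold secSq
  rw [norm_smul, inner_smul_left, mul_pow, mul_pow]
  simp only [Real.norm_eq_abs, sq_abs, conj_trivial]
  exact mul_div_mul_left _ _ (pow_ne_zero 2 ha)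

/-- One step of Krasulina's method with step size `γ` and covariance operator `A`. -/
noncomputable def krasulinaStep (γ : ℝ) (A : E →ₗ[ℝ] E) (v : E) : E :=
  v + γ • (A v - ((inner ℝ v (A v) : ℝ) / ‖v‖ ^ 2) • v)

theorem krasulinaStep_smul (γ : ℝ) (A : E →ₗ[ℝ] E) (v : E) {a : ℝ} (ha : a ≠ 0) :
    krasulinaStep γ A (a • v) = a • krasulinaStep γ A v := by
  have h : (inner ℝ (a • v) (A (a • v)) : ℝ) / ‖a • v‖ ^ 2 = (inner ℝ v (A v) : ℝ) / ‖v‖ ^ 2 := by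
    rw [map_smul, inner_smul_left, inner_smul_right, norm_smul, mul_pow]
    simp only [Real.norm_eq_abs, sq_abs, conj_trivial]
    rw [← mul_assoc, ← sq]
    exact mul_div_mul_left _ _ (pow_ne_zero 2 ha)
  unfold krasulinaStep
  rw [h, map_smul]
  module

/-- The Taylor coefficient `3` is raised to `4`: the product of the right side with `(1 + x)²` is `1
+ x²(1 + 6x + 4x²)`. -/
theorem inv_one_add_sq_le {x : ℝ} (hx : |x| ≤ 1 / 10) :
    1 / (1 + x) ^ 2 ≤ 1 - 2 * x + 4 * x ^ 2 := by
  obtain ⟨h1, h2⟩ := abs_le.1 hx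
  rw [div_le_iff₀ (by nlinarith)]
  nlinarith [mul_nonneg (sq_nonneg x) (by nlinarith : 0 ≤ 1 + 6 * x + 4 * x ^ 2)]

theorem one_add_mul_inv_sq_le {x X : ℝ} (hx : |x| ≤ 1 / 10) (hX : 0 ≤ X) :
    (1 + X) * (1 / (1 + x) ^ 2) ≤ 1 - 2 * x + 4 * x ^ 2 + 1.3 * X := by
  obtain ⟨h1, h2⟩ := abs_le.1 hx
  have h3 : 1 - 2 * x + 4 * x ^ 2 ≤ 1.3 := by nlinarith
  calc (1 + X) * (1 / (1 + x) ^ 2) ≤ (1 + X) * (1 - 2 * x + 4 * x ^ 2) :=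
        mul_le_mul_of_nonneg_left (inv_one_add_sq_le hx) (by linarith)
    _ ≤ _ := by linarith [mul_le_mul_of_nonneg_left h3 hX]

/-- The scalar bookkeeping of `secSq_krasulinaStep_le`: `w2` is `cos²`, `R` is `sec²`, `D` the
Rayleigh deficit `λ₁ - uᵀSu`, and `k`, `i` are linear in the noise. The identity `R (1 - w2) = R -
1` turns every bound by `sin²` into one by `tan²`; the drift then contributes `4 + 1.3 ≤ 6` times
`γ²λ₁²`. -/
theorem second_order_bound {R' R w2 D G2 n2 F l₁ g γ k i : ℝ} (hγ : 0 ≤ γ) (hR : 0 < R)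
    (hΨ : 0 ≤ 1 - w2) (hw2 : 0 ≤ w2) (hRΨ : R * (1 - w2) = R - 1)
    (hlow : g * (1 - w2) ≤ D) (hD : 0 ≤ D) (hup : D ≤ l₁ * (1 - w2))
    (hG : G2 ≤ l₁ ^ 2 * (1 - w2)) (hn : n2 ≤ F) (hk : R * k ^ 2 ≤ R * ((R - 1) * F))
    (hmain : R' ≤ R * (1 - 2 * (γ * (D + k)) + 4 * (γ * (D + k)) ^ 2 +
      1.3 * (γ ^ 2 * (G2 + 2 * i + n2)))) :
    R' - 1 ≤ (R - 1) * (1 - 2 * γ * g + 6 * γ ^ 2 * l₁ ^ 2) +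
      R * ((-2 * γ + 8 * γ ^ 2 * D) * k + 2.6 * γ ^ 2 * i) +
      γ ^ 2 * R * (4 * (R - 1) + 1.3) * F := by
  have hD2 : D ^ 2 ≤ l₁ ^ 2 * (1 - w2) := by
    have h1 : D ^ 2 ≤ (l₁ * (1 - w2)) ^ 2 := pow_le_pow_left₀ hD hup 2
    have h2 : (1 - w2) ^ 2 ≤ 1 - w2 := by nlinarith
    nlinarith [mul_le_mul_of_nonneg_left h2 (sq_nonneg l₁)]
  have hR1 : 0 ≤ R - 1 := by rw [← hRΨ]; positivity
  have hγ2 := sq_nonneg γ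
  have e1 : R * D ^ 2 ≤ l₁ ^ 2 * (R - 1) := by
    rw [← hRΨ]; linarith [mul_le_mul_of_nonneg_left hD2 hR.le]
  have e2 : R * G2 ≤ l₁ ^ 2 * (R - 1) := by
    rw [← hRΨ]; linarith [mul_le_mul_of_nonneg_left hG hR.le]
  have e3 : R * n2 ≤ R * F := mul_le_mul_of_nonneg_left hn hR.le
  have e4 : g * (R - 1) ≤ R * D := by
    rw [← hRΨ]; linarith [mul_le_mul_of_nonneg_left hlow hR.le]
  have f1 := mul_le_mul_of_nonneg_left e1 hγ2
  have f2 := mul_le_mul_of_nonneg_left e2 hγ2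
  have f3 := mul_le_mul_of_nonneg_left e3 hγ2
  have f4 := mul_le_mul_of_nonneg_left e4 hγ
  have f5 := mul_le_mul_of_nonneg_left hk hγ2
  have f6 : 0 ≤ γ ^ 2 * (l₁ ^ 2 * (R - 1)) := by positivity
  linarith

theorem inner_krasulinaStep {u q : E} (hu : ‖u‖ = 1) (S M : E →ₗ[ℝ] E) {l₁ : ℝ} (γ : ℝ)
    (hw : inner ℝ u q ≠ (0 : ℝ)) (hSq : inner ℝ q (S u) = l₁ * inner ℝ u q) :
    inner ℝ (krasulinaStep γ (S + M) u) q = inner ℝ u q * (1 + γ * ((l₁ - inner ℝ u (S u)) +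
      inner ℝ (q - (inner ℝ u q : ℝ) • u) (M u) / inner ℝ u q)) := by
  unfold krasulinaStep
  rw [hu, inner_add_left, inner_smul_left, inner_sub_left, inner_smul_left, LinearMap.add_apply,
    inner_add_left, inner_add_right, real_inner_comm q (S u), real_inner_comm q (M u), hSq,
    inner_sub_left, inner_smul_left]
  simp only [conj_trivial]
  field_simp
  ring

/-- The change of `tan²` of the angle to the top eigenvector `q` of `S` in one step with the
perturbed operator `S + M`: a contraction, a term that is linear in `M`, and a term of second
order. -/
theorem secSq_krasulinaStep_le {u q : E} (hu : ‖u‖ = 1) (hq : ‖q‖ = 1) (S M : E →ₗ[ℝ] E)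
    {l₁ g γ F : ℝ} (hγ : 0 ≤ γ) (hw : inner ℝ u q ≠ (0 : ℝ))
    (hSq : inner ℝ q (S u) = l₁ * inner ℝ u q)
    (hlow : g * (1 - (inner ℝ u q : ℝ) ^ 2) ≤ l₁ - inner ℝ u (S u))
    (hlow0 : 0 ≤ l₁ - inner ℝ u (S u))
    (hup : l₁ - inner ℝ u (S u) ≤ l₁ * (1 - (inner ℝ u q : ℝ) ^ 2))
    (hSu : ‖S u - (inner ℝ u (S u) : ℝ) • u‖ ^ 2 ≤ l₁ ^ 2 * (1 - (inner ℝ u q : ℝ) ^ 2))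
    (hM : ‖M u‖ ^ 2 ≤ F)
    (hsmall : |γ * ((l₁ - inner ℝ u (S u)) +
      inner ℝ (q - (inner ℝ u q : ℝ) • u) (M u) / inner ℝ u q)| ≤ 1 / 10) :
    secSq q (krasulinaStep γ (S + M) u) - 1 ≤
      (secSq q u - 1) * (1 - 2 * γ * g + 6 * γ ^ 2 * l₁ ^ 2) +
      inner ℝ (secSq q u • (((-2 * γ + 8 * γ ^ 2 * (l₁ - inner ℝ u (S u))) / inner ℝ u q) •
          (q - (inner ℝ u q : ℝ) • u) +
        (2.6 * γ ^ 2) • (S u - (inner ℝ u (S u) : ℝ) • u))) (M u) +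
      γ ^ 2 * secSq q u * (4 * (secSq q u - 1) + 1.3) * F := by
  set w : ℝ := inner ℝ u q with hwdef
  set D : ℝ := l₁ - inner ℝ u (S u) with hD
  set m : ℝ := inner ℝ (q - w • u) (M u) with hm
  set G : E := S u - (inner ℝ u (S u) : ℝ) • u with hG
  set n : E := M u - (inner ℝ u (M u) : ℝ) • u with hn
  set η : ℝ := D + m / w with hη
  set R : ℝ := secSq q u with hR
  have hRw : R = 1 / w ^ 2 := by rw [hR, secSq, hu, ← hwdef]; norm_num
  have hw2 : 0 < w ^ 2 := by positivity
  have hstep : krasulinaStep γ (S + M) u = u + γ • (G + n) := by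
    unfold krasulinaStep
    -- The increment is the sum of the residuals of signal and noise, both orthogonal to `u`; hence
    -- the norm changes only at order `γ²`.
    rw [hu, hG, hn, LinearMap.add_apply, inner_add_right]
    module
  have horth : inner ℝ u (G + n) = 0 := by
    rw [inner_add_right, inner_sub_inner_smul_self hu, inner_sub_inner_smul_self hu, add_zero]
  have hnorm : ‖u + γ • (G + n)‖ ^ 2 = 1 + γ ^ 2 * ‖G + n‖ ^ 2 := by
    rw [norm_add_sq_real, inner_smul_right, horth, hu, norm_smul, mul_pow]
    simp
  have hinn : inner ℝ (u + γ • (G + n)) q = w * (1 + γ * η) := by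
    rw [← hstep, inner_krasulinaStep hu S M γ hw hSq]
  have hGn : ‖G + n‖ ^ 2 = ‖G‖ ^ 2 + 2 * inner ℝ G (M u) + ‖n‖ ^ 2 := by
    have h0 : inner ℝ G u = 0 := by
      rw [real_inner_comm]; exact inner_sub_inner_smul_self hu _
    rw [norm_add_sq_real, hn, inner_sub_right, inner_smul_right, h0]
    ring
  have hnF : ‖n‖ ^ 2 ≤ F := by
    rw [hn, norm_sq_sub_inner_smul hu]
    nlinarith [sq_nonneg (inner ℝ u (M u) : ℝ)]
  have hm2 : m ^ 2 ≤ (1 - w ^ 2) * F := by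
    have h1 : ‖q - w • u‖ ^ 2 = 1 - w ^ 2 := by
      rw [hwdef, norm_sq_sub_inner_smul hu, hq]; norm_num
    have h2 := abs_real_inner_le_norm (q - w • u) (M u)
    calc m ^ 2 = |m| ^ 2 := (sq_abs m).symm
      _ ≤ (‖q - w • u‖ * ‖M u‖) ^ 2 := pow_le_pow_left₀ (abs_nonneg _) h2 2
      _ = (1 - w ^ 2) * ‖M u‖ ^ 2 := by rw [mul_pow, h1]
      _ ≤ _ := by
        apply mul_le_mul_of_nonneg_left hM
        rw [← h1]; positivity
  have hΨ : 0 ≤ 1 - w ^ 2 := by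
    have h1 : ‖q - w • u‖ ^ 2 = 1 - w ^ 2 := by
      rw [hwdef, norm_sq_sub_inner_smul hu, hq]; norm_num
    rw [← h1]; positivity
  have hRpos : 0 < R := by rw [hRw]; positivity
  have hRΨ : R * (1 - w ^ 2) = R - 1 := by rw [hRw]; field_simp
  have hmain : secSq q (krasulinaStep γ (S + M) u) ≤
      R * (1 - 2 * (γ * η) + 4 * (γ * η) ^ 2 + 1.3 * (γ ^ 2 * ‖G + n‖ ^ 2)) := by
    rw [hstep, secSq, hnorm, hinn]
    have e : (1 + γ ^ 2 * ‖G + n‖ ^ 2) / (w * (1 + γ * η)) ^ 2 =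
        R * ((1 + γ ^ 2 * ‖G + n‖ ^ 2) * (1 / (1 + γ * η) ^ 2)) := by
      rw [hRw, mul_pow]
      rw [div_mul_eq_div_div_swap]
      ring
    rw [e]
    apply mul_le_mul_of_nonneg_left _ hRpos.le
    have hX : 0 ≤ γ ^ 2 * ‖G + n‖ ^ 2 := by positivity
    exact one_add_mul_inv_sq_le hsmall hX
  have hlin : inner ℝ (R • (((-2 * γ + 8 * γ ^ 2 * D) / w) • (q - w • u) +
        (2.6 * γ ^ 2) • G)) (M u) =
      R * ((-2 * γ + 8 * γ ^ 2 * D) * (m / w) + 2.6 * γ ^ 2 * inner ℝ G (M u)) := by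
    rw [inner_smul_left, inner_add_left, inner_smul_left, inner_smul_left, ← hm]
    simp only [conj_trivial]
    ring
  rw [hlin]
  have hmw : R * (m / w) ^ 2 ≤ R * ((R - 1) * F) := by
    apply mul_le_mul_of_nonneg_left _ hRpos.le
    rw [div_pow, div_le_iff₀ hw2, ← hRΨ]
    calc m ^ 2 ≤ (1 - w ^ 2) * F := hm2
      _ = R * (1 - w ^ 2) * F * w ^ 2 := by rw [hRw]; field_simp
  have hL : R * (1 - 2 * (γ * η) + 4 * (γ * η) ^ 2 + 1.3 * (γ ^ 2 * ‖G + n‖ ^ 2)) =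
      R * (1 - 2 * (γ * (D + m / w)) + 4 * (γ * (D + m / w)) ^ 2 +
        1.3 * (γ ^ 2 * (‖G‖ ^ 2 + 2 * inner ℝ G (M u) + ‖n‖ ^ 2))) := by
    rw [hη, hGn]
  rw [hL] at hmain
  exact second_order_bound hγ hRpos hΨ hw2.le hRΨ hlow hlow0 hup hSu hnF hmw hmain

end Geometry

/-! ### Matrices as operators; the mini-batch update as a Krasulina step. -/

section MatrixOperators

variable {d : ℕ}

/-- The operator on Euclidean space that a matrix defines. -/
noncomputable abbrev matOp (A : Matrix (Fin d) (Fin d) ℝ) : Vec d →ₗ[ℝ] Vec d :=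
  Matrix.toLpLin 2 2 A

theorem matOp_apply (A : Matrix (Fin d) (Fin d) ℝ) (v : Vec d) (i : Fin d) :
    matOp A v i = ∑ j, A i j * v j := by
  simp [matOp, Matrix.toLpLin_apply, Matrix.mulVec, dotProduct]

theorem inner_vec (u v : Vec d) : inner ℝ u v = ∑ i, u i * v i := by
  simp [PiLp.inner_apply, mul_comm]

theorem inner_matOp (A : Matrix (Fin d) (Fin d) ℝ) (u v : Vec d) :
    inner ℝ u (matOp A v) = ∑ i, ∑ j, u i * v j * A i j := by
  rw [inner_vec]
  refine Finset.sum_congr rfl fun i _ => ?_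
  rw [matOp_apply, Finset.mul_sum]
  exact Finset.sum_congr rfl fun j _ => by ring

theorem matOp_outer (x v : Vec d) : matOp (outer x) v = (inner ℝ x v : ℝ) • x := by
  ext i
  rw [matOp_apply, inner_vec]
  simp only [outer, Matrix.of_apply, PiLp.smul_apply, smul_eq_mul, Finset.sum_mul]
  exact Finset.sum_congr rfl fun j _ => by ring

theorem norm_matOp_sq_le (A : Matrix (Fin d) (Fin d) ℝ) (v : Vec d) :
    ‖matOp A v‖ ^ 2 ≤ frobSq A * ‖v‖ ^ 2 := by
  rw [EuclideanSpace.norm_sq_eq, EuclideanSpace.norm_sq_eq, frobSq, Finset.sum_mul]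
  refine Finset.sum_le_sum fun i _ => ?_
  rw [matOp_apply]
  simpa using Finset.sum_mul_sq_le_sq_mul_sq Finset.univ (fun j => A i j) (fun j => v j)

theorem matOp_batchCov {N b : ℕ} (y : Fin N → Fin b → Vec d) (v : Vec d) :
    matOp (batchCov y) v =
      (1 / ((N * b : ℕ) : ℝ)) • ∑ i, ∑ j, (inner ℝ (y i j) v : ℝ) • y i j := by
  unfold batchCov matOp
  rw [map_smul, map_sum]
  simp only [map_sum, LinearMap.smul_apply, LinearMap.sum_apply]
  congr 1
  exact Finset.sum_congr rfl fun i _ => Finset.sum_congr rfl fun j _ => matOp_outer _ _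

/-- The direction is linear in `x xᵀ`, so the average of the sample directions is the direction of
the averaged matrix. The update thus sees the batch only through `A_t`. -/
theorem krasulinaDir_sum {N b : ℕ} (y : Fin N → Fin b → Vec d)
    (v : Vec d) :
    (1 / ((N * b : ℕ) : ℝ)) • ∑ i, ∑ j, krasulinaDir (y i j) v =
      matOp (batchCov y) v - ((inner ℝ v (matOp (batchCov y) v) : ℝ) / ‖v‖ ^ 2) • v := by
  rw [matOp_batchCov, inner_smul_right, inner_sum]
  simp only [inner_sum, inner_smul_right, krasulinaDir, Finset.sum_sub_distrib, smul_sub]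
  congr 1
  simp only [← Finset.sum_smul, smul_smul]
  congr 1
  rw [mul_div_assoc, Finset.sum_div]
  congr 1
  refine Finset.sum_congr rfl fun i _ => ?_
  rw [Finset.sum_div]
  refine Finset.sum_congr rfl fun j _ => ?_
  rw [real_inner_comm, sq]

theorem dmk_succ {N b : ℕ} (γ : ℕ → ℝ) (v₀ : Vec d)
    (y : ℕ → Fin N → Fin b → Vec d) (t : ℕ) :
    dmk γ v₀ y (t + 1) =
      krasulinaStep (γ (t + 1)) (matOp (batchCov (y t))) (dmk γ v₀ y t) := by
  rw [dmk, krasulinaDir_sum]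
  rfl

theorem norm_matOp_batchCov_le {N b : ℕ} (hN : 0 < N) (hb : 0 < b) {y : Fin N → Fin b → Vec d}
    {r : ℝ} (hy : ∀ i j, ‖y i j‖ ≤ r) (v : Vec d) :
    ‖matOp (batchCov y) v‖ ≤ r ^ 2 * ‖v‖ := by
  have hB : (0 : ℝ) < ((N * b : ℕ) : ℝ) := by positivity
  rw [matOp_batchCov, norm_smul, Real.norm_of_nonneg (by positivity), one_div,
    inv_mul_le_iff₀ hB]
  have h : ∀ i j, ‖(inner ℝ (y i j) v : ℝ) • y i j‖ ≤ r ^ 2 * ‖v‖ := fun i j => by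
    rw [norm_smul]
    have h1 := norm_inner_le_norm (𝕜 := ℝ) (y i j) v
    have hr : 0 ≤ r := (norm_nonneg _).trans (hy i j)
    calc _ ≤ (‖y i j‖ * ‖v‖) * ‖y i j‖ := by gcongr
      _ ≤ (r * ‖v‖) * r := by gcongr <;> exact hy i j
      _ = _ := by ring
  calc _ ≤ ∑ i : Fin N, ∑ j : Fin b, r ^ 2 * ‖v‖ :=
        (norm_sum_le _ _).trans (Finset.sum_le_sum fun i _ =>
          (norm_sum_le _ _).trans (Finset.sum_le_sum fun j _ => h i j))
    _ = _ := by simp; ring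

theorem frobSq_nonneg (A : Matrix (Fin d) (Fin d) ℝ) : 0 ≤ frobSq A := by
  unfold frobSq; positivity

end MatrixOperators

/-! ### Spectral estimates for the covariance matrix. -/

section Spectrum

variable {d : ℕ}

theorem exists_eigenbasis (P : Measure (Vec d)) :
    ∃ e : OrthonormalBasis (Fin d) ℝ (Vec d),
      ∀ i, matOp (covMat P) (e i) = covEig P i • e i := by
  let hA := covMat_isHermitian P
  let s : Fin (Fintype.card (Fin d)) ≃ Fin d := Fintype.equivOfCardEq (Fintype.card_fin _)
  refine ⟨hA.eigenvectorBasis.reindex (s.symm.trans (finCongr (Fintype.card_fin d))), fun i => ?_⟩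
  rw [OrthonormalBasis.reindex_apply]
  have h := hA.mulVec_eigenvectorBasis
    ((s.symm.trans (finCongr (Fintype.card_fin d))).symm i)
  rw [Matrix.toLpLin_apply, h]
  have : hA.eigenvalues ((s.symm.trans (finCongr (Fintype.card_fin d))).symm i) = covEig P i := by
    unfold Matrix.IsHermitian.eigenvalues covEig
    congr 1
    simp [s]
  rw [this]
  rfl

theorem covEig_antitone (P : Measure (Vec d)) : Antitone (covEig P) := fun i j hij =>
  (covMat_isHermitian P).eigenvalues₀_antitone (by simpa using hij)

theorem ae_abs_apply_le {P : Measure (Vec d)} {r : ℝ} (hbound : ∀ᵐ x ∂P, ‖x‖ ≤ r) :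
    ∀ᵐ x ∂P, ∀ i, |x i| ≤ r := by
  filter_upwards [hbound] with x hx i
  exact (by simpa using EuclideanSpace.norm_eq x ▸ PiLp.norm_apply_le x i : |x i| ≤ ‖x‖).trans hx

theorem measurable_outer (i j : Fin d) : Measurable fun x : Vec d => outer x i j := by
  unfold outer
  simp only [Matrix.of_apply]
  fun_prop

theorem integrable_outer {P : Measure (Vec d)} [IsProbabilityMeasure P] {r : ℝ}
    (hbound : ∀ᵐ x ∂P, ‖x‖ ≤ r) (i j : Fin d) : Integrable (fun x => outer x i j) P := by
  refine Integrable.of_bound (measurable_outer i j).aestronglyMeasurable (r * r) ?_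
  filter_upwards [ae_abs_apply_le hbound] with x hx
  rw [outer, Matrix.of_apply, Real.norm_eq_abs, abs_mul]
  exact mul_le_mul (hx i) (hx j) (abs_nonneg _) ((abs_nonneg _).trans (hx i))

theorem inner_matOp_covMat {P : Measure (Vec d)} [IsProbabilityMeasure P] {r : ℝ}
    (hbound : ∀ᵐ x ∂P, ‖x‖ ≤ r) (u : Vec d) :
    inner ℝ u (matOp (covMat P) u) = ∫ x, (inner ℝ x u : ℝ) ^ 2 ∂P := by
  rw [inner_matOp]
  have h : ∀ x : Vec d, (inner ℝ x u : ℝ) ^ 2 = ∑ i, ∑ j, u i * u j * outer x i j := fun x => by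
    rw [← inner_matOp, matOp_outer, inner_smul_right, real_inner_comm, sq]
  simp only [h]
  rw [integral_finsetSum _ fun i _ => integrable_finsetSum _ fun j _ =>
    (integrable_outer hbound i j).const_mul _]
  refine Finset.sum_congr rfl fun i _ => ?_
  rw [integral_finsetSum _ fun j _ => (integrable_outer hbound i j).const_mul _]
  exact Finset.sum_congr rfl fun j _ => by rw [integral_const_mul]; rfl

theorem covEig_nonneg {P : Measure (Vec d)} [IsProbabilityMeasure P] {r : ℝ}
    (hbound : ∀ᵐ x ∂P, ‖x‖ ≤ r) (i : Fin d) : 0 ≤ covEig P i := by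
  obtain ⟨e, he⟩ := exists_eigenbasis P
  have h := inner_matOp_covMat hbound (e i)
  rw [he, inner_smul_right, real_inner_self_eq_norm_sq, e.norm_eq_one] at h
  have : 0 ≤ ∫ x, (inner ℝ x (e i) : ℝ) ^ 2 ∂P := integral_nonneg fun x => sq_nonneg _
  linarith

theorem covEig_le {P : Measure (Vec d)} [IsProbabilityMeasure P] {r : ℝ}
    (hbound : ∀ᵐ x ∂P, ‖x‖ ≤ r) (i : Fin d) : covEig P i ≤ r ^ 2 := by
  obtain ⟨e, he⟩ := exists_eigenbasis P
  have h := inner_matOp_covMat hbound (e i)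
  rw [he, inner_smul_right, real_inner_self_eq_norm_sq, e.norm_eq_one] at h
  have : ∫ x, (inner ℝ x (e i) : ℝ) ^ 2 ∂P ≤ ∫ _x, r ^ 2 ∂P := by
    refine integral_mono_of_nonneg (.of_forall fun x => sq_nonneg _) (integrable_const _) ?_
    filter_upwards [hbound] with x hx
    have h1 := abs_real_inner_le_norm x (e i)
    rw [e.norm_eq_one, mul_one] at h1
    exact sq_le_sq' (by linarith [(abs_le.1 h1).1]) (by linarith [(abs_le.1 h1).2])
  simp at this
  linarith

/-- What the spectral decomposition of the covariance matrix says about a unit vector `u`. -/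
theorem spectral_facts (hd : 2 ≤ d) {P : Measure (Vec d)} [IsProbabilityMeasure P] {r : ℝ}
    (hbound : ∀ᵐ x ∂P, ‖x‖ ≤ r) (hgap : secondEig hd P < topEig hd P)
    {q : Vec d} (hq : ‖q‖ = 1)
    (hqeig : matOp (covMat P) q = topEig hd P • q) {u : Vec d} (hu : ‖u‖ = 1) :
    inner ℝ q (matOp (covMat P) u) = topEig hd P * inner ℝ u q ∧
    (topEig hd P - secondEig hd P) * (1 - (inner ℝ u q : ℝ) ^ 2) ≤
      topEig hd P - inner ℝ u (matOp (covMat P) u) ∧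
    topEig hd P - inner ℝ u (matOp (covMat P) u) ≤
      topEig hd P * (1 - (inner ℝ u q : ℝ) ^ 2) ∧
    ‖matOp (covMat P) u - (inner ℝ u (matOp (covMat P) u) : ℝ) • u‖ ^ 2 ≤
      topEig hd P ^ 2 * (1 - (inner ℝ u q : ℝ) ^ 2) := by
  obtain ⟨e, he⟩ := exists_eigenbasis P
  set S := matOp (covMat P) with hS
  set l₁ := topEig hd P with hl₁
  have hsymm : ∀ x y : Vec d, inner ℝ x (S y) = inner ℝ (S x) y := fun x y => by
    rw [real_inner_comm y (S x)]
    rw [hS, inner_matOp, inner_matOp, Finset.sum_comm]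
    refine Finset.sum_congr rfl fun i _ => Finset.sum_congr rfl fun j _ => ?_
    have : covMat P i j = covMat P j i := by simp [covMat, outer, mul_comm]
    rw [this]; ring
  let i₀ : Fin d := ⟨0, by omega⟩
  have hl : ∀ i, i ≠ i₀ → covEig P i ≤ secondEig hd P := fun i hi =>
    covEig_antitone P (by
      rw [Fin.le_def]
      have : i.val ≠ 0 := fun h => hi (Fin.ext h)
      show 1 ≤ i.val
      omega)
  have hcoord : ∀ (v : Vec d) i, inner ℝ (e i) (S v) = covEig P i * inner ℝ (e i) v := fun v i => by
    rw [hsymm, he, inner_smul_left]; simp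
  -- The gap makes `λ₁` simple, so `q` is `± e i₀` and `⟨u, q⟩²` is the square of a single
  -- coordinate of `u`.
  have hq0 : ∀ i, i ≠ i₀ → inner ℝ (e i) q = (0 : ℝ) := fun i hi => by
    have h1 := hcoord q i
    rw [hqeig, inner_smul_right] at h1
    have h2 : (l₁ - covEig P i) * inner ℝ (e i) q = 0 := by rw [sub_mul, h1]; ring
    rcases mul_eq_zero.1 h2 with h | h
    · have := hl i hi; linarith
    · exact h
  have hqe : (inner ℝ (e i₀) q : ℝ) ^ 2 = 1 := by
    have h := e.sum_sq_norm_inner_right q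
    rw [Finset.sum_eq_single i₀ (fun i _ hi => by rw [hq0 i hi]; simp) (by simp), hq] at h
    simpa using h
  have hw : (inner ℝ u q : ℝ) ^ 2 = (inner ℝ (e i₀) u : ℝ) ^ 2 := by
    have h := e.sum_inner_mul_inner u q
    rw [Finset.sum_eq_single i₀ (fun i _ hi => by rw [hq0 i hi]; simp) (by simp)] at h
    rw [← h, mul_pow, hqe, real_inner_comm]; ring
  have hsum : ∑ i, (inner ℝ (e i) u : ℝ) ^ 2 = 1 := by
    have h := e.sum_sq_norm_inner_right u
    rw [hu] at h; simpa using h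
  have hΨ : 1 - (inner ℝ u q : ℝ) ^ 2 = ∑ i ∈ Finset.univ.erase i₀, (inner ℝ (e i) u : ℝ) ^ 2 := by
    rw [hw, ← hsum, ← Finset.add_sum_erase _ _ (Finset.mem_univ i₀)]; ring
  have hquad : l₁ - inner ℝ u (S u) =
      ∑ i ∈ Finset.univ.erase i₀, (l₁ - covEig P i) * (inner ℝ (e i) u : ℝ) ^ 2 := by
    have h1 : inner ℝ u (S u) = ∑ i, covEig P i * (inner ℝ (e i) u : ℝ) ^ 2 := by
      rw [← e.sum_inner_mul_inner u (S u)]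
      refine Finset.sum_congr rfl fun i _ => ?_
      rw [hcoord, real_inner_comm]; ring
    have h2 : l₁ = ∑ i, l₁ * (inner ℝ (e i) u : ℝ) ^ 2 := by
      rw [← Finset.mul_sum, hsum, mul_one]
    calc l₁ - inner ℝ u (S u)
        = ∑ i, (l₁ - covEig P i) * (inner ℝ (e i) u : ℝ) ^ 2 := by
          rw [h1]; nth_rewrite 1 [h2]
          rw [← Finset.sum_sub_distrib]
          exact Finset.sum_congr rfl fun i _ => by ring
      _ = _ := by
          rw [← Finset.add_sum_erase _ _ (Finset.mem_univ i₀)]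
          have : l₁ = covEig P i₀ := rfl
          rw [this]; ring
  have hsq : ‖S u - l₁ • u‖ ^ 2 =
      ∑ i ∈ Finset.univ.erase i₀, (l₁ - covEig P i) ^ 2 * (inner ℝ (e i) u : ℝ) ^ 2 := by
    rw [← e.sum_sq_norm_inner_right (S u - l₁ • u), ← Finset.add_sum_erase _ _ (Finset.mem_univ i₀)]
    have h : ∀ i, ‖(inner ℝ (e i) (S u - l₁ • u) : ℝ)‖ ^ 2 =
        (l₁ - covEig P i) ^ 2 * (inner ℝ (e i) u : ℝ) ^ 2 := fun i => by
      rw [inner_sub_right, hcoord, inner_smul_right, Real.norm_eq_abs, sq_abs]; ring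
    rw [h i₀]
    have : l₁ = covEig P i₀ := rfl
    rw [← this, sub_self]
    simp only [h]
    ring
  refine ⟨?_, ?_, ?_, ?_⟩
  · rw [hsymm, hqeig, inner_smul_left, real_inner_comm]; simp
  · rw [hΨ, hquad, Finset.mul_sum]
    refine Finset.sum_le_sum fun i hi => mul_le_mul_of_nonneg_right ?_ (sq_nonneg _)
    linarith [hl i (Finset.ne_of_mem_erase hi)]
  · rw [hΨ, hquad, Finset.mul_sum]
    refine Finset.sum_le_sum fun i hi => mul_le_mul_of_nonneg_right ?_ (sq_nonneg _)
    linarith [covEig_nonneg hbound i]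
  -- The Rayleigh quotient gives the point of the line through `u` nearest to `S u`; replacing it by
  -- `l₁` removes the top coordinate.
  · have h1 : ‖S u - (inner ℝ u (S u) : ℝ) • u‖ ^ 2 ≤ ‖S u - l₁ • u‖ ^ 2 := by
      rw [norm_sq_sub_inner_smul hu, norm_sub_sq_real, norm_smul, mul_pow, hu, inner_smul_right,
        real_inner_comm]
      simp only [Real.norm_eq_abs, sq_abs]
      nlinarith [sq_nonneg (l₁ - inner ℝ (S u) u)]
    refine h1.trans ?_
    rw [hsq, hΨ, Finset.mul_sum]
    refine Finset.sum_le_sum fun i hi => mul_le_mul_of_nonneg_right ?_ (sq_nonneg _)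
    have h2 := hl i (Finset.ne_of_mem_erase hi)
    have h3 := covEig_nonneg hbound i
    nlinarith

end Spectrum

/-! ### Mean and variance of the mini-batch error. -/

section Batch

variable {d N b : ℕ} {P : Measure (Vec d)} [IsProbabilityMeasure P] {r : ℝ}

/-- The error of the sample covariance of a mini-batch. -/
noncomputable abbrev batchErr (P : Measure (Vec d)) (y : Fin N × Fin b → Vec d) :
    Matrix (Fin d) (Fin d) ℝ :=
  batchCov (fun i j => y (i, j)) - covMat P

theorem batchCov_apply (y : Fin N × Fin b → Vec d) (k l : Fin d) :
    batchCov (fun i j => y (i, j)) k l =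
      (1 / ((N * b : ℕ) : ℝ)) * ∑ p : Fin N × Fin b, outer (y p) k l := by
  rw [batchCov, Matrix.smul_apply, smul_eq_mul, Fintype.sum_prod_type, Matrix.sum_apply]
  simp only [Matrix.sum_apply]

theorem ae_pi_norm_le (hbound : ∀ᵐ x ∂P, ‖x‖ ≤ r) :
    ∀ᵐ y ∂(Measure.pi fun _ : Fin N × Fin b => P), ∀ p, ‖y p‖ ≤ r := by
  rw [ae_all_iff]
  exact fun p => (Measure.quasiMeasurePreserving_eval (fun _ : Fin N × Fin b => P) p).ae hbound

theorem memLp_outer (hbound : ∀ᵐ x ∂P, ‖x‖ ≤ r) (k l : Fin d) (e : ENNReal) :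
    MemLp (fun x => outer x k l) e P := by
  refine MemLp.of_bound (C := r * r) (measurable_outer k l).aestronglyMeasurable ?_
  filter_upwards [ae_abs_apply_le hbound] with x hx
  rw [outer, Matrix.of_apply, Real.norm_eq_abs, abs_mul]
  exact mul_le_mul (hx k) (hx l) (abs_nonneg _) ((abs_nonneg _).trans (hx k))

theorem memLp_outer_eval (hbound : ∀ᵐ x ∂P, ‖x‖ ≤ r) (k l : Fin d) (p : Fin N × Fin b)
    (e : ENNReal) :
    MemLp (fun y : Fin N × Fin b → Vec d => outer (y p) k l) e (Measure.pi fun _ => P) :=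
  (memLp_outer hbound k l e).comp_measurePreserving (measurePreserving_eval _ p)

theorem integral_outer_eval (k l : Fin d) (p : Fin N × Fin b) :
    ∫ y : Fin N × Fin b → Vec d, outer (y p) k l ∂(Measure.pi fun _ => P) = covMat P k l := by
  have := (measurePreserving_eval (fun _ : Fin N × Fin b => P) p).map_eq
  rw [covMat, Matrix.of_apply]
  nth_rewrite 2 [← this]
  rw [integral_map (measurable_pi_apply p).aemeasurable
    (measurable_outer k l).aestronglyMeasurable]

theorem memLp_batchErr (hbound : ∀ᵐ x ∂P, ‖x‖ ≤ r) (k l : Fin d) (e : ENNReal) :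
    MemLp (fun y : Fin N × Fin b → Vec d => batchErr P y k l) e (Measure.pi fun _ => P) := by
  simp only [batchErr, Matrix.sub_apply, batchCov_apply]
  exact ((memLp_finsetSum _ fun p _ => memLp_outer_eval hbound k l p e).const_mul _).sub
    (memLp_const _)

theorem integral_batchErr (hN : 0 < N) (hb : 0 < b) (hbound : ∀ᵐ x ∂P, ‖x‖ ≤ r) (k l : Fin d) :
    ∫ y : Fin N × Fin b → Vec d, batchErr P y k l ∂(Measure.pi fun _ => P) = 0 := by
  have hB : ((N * b : ℕ) : ℝ) ≠ 0 := by positivity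
  have hi : ∀ p : Fin N × Fin b, Integrable (fun y : Fin N × Fin b → Vec d => outer (y p) k l)
      (Measure.pi fun _ => P) := fun p => memLp_one_iff_integrable.1 (memLp_outer_eval hbound k l p 1)
  simp only [batchErr, Matrix.sub_apply, batchCov_apply]
  rw [integral_sub ((integrable_finsetSum _ fun p _ => hi p).const_mul _) (integrable_const _),
    integral_const_mul, integral_finsetSum _ fun p _ => hi p]
  simp only [integral_outer_eval]
  simp only [Finset.sum_const, Finset.card_univ, Fintype.card_prod, Fintype.card_fin, nsmul_eq_mul,
    integral_const, probReal_univ, one_smul]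
  field_simp
  ring

theorem integrable_batchErr_sq (hbound : ∀ᵐ x ∂P, ‖x‖ ≤ r) (k l : Fin d) :
    Integrable (fun y : Fin N × Fin b → Vec d => batchErr P y k l ^ 2) (Measure.pi fun _ => P) :=
  (memLp_batchErr hbound k l 2).integrable_sq

theorem integrable_frobSq_batchErr (hbound : ∀ᵐ x ∂P, ‖x‖ ≤ r) :
    Integrable (fun y : Fin N × Fin b → Vec d => frobSq (batchErr P y))
      (Measure.pi fun _ => P) :=
  integrable_finsetSum _ fun k _ => integrable_finsetSum _ fun l _ =>
    integrable_batchErr_sq hbound k l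

theorem batchVar_nonneg (P : Measure (Vec d)) (N b : ℕ) : 0 ≤ batchVar P N b :=
  integral_nonneg fun _ => frobSq_nonneg _

theorem sampleVar_nonneg (P : Measure (Vec d)) : 0 ≤ sampleVar P := integral_nonneg fun _ => frobSq_nonneg _

/-- Averaging over `N * b` independent samples divides the variance by `N * b`. -/
theorem batchVar_eq (hN : 0 < N) (hb : 0 < b) (hbound : ∀ᵐ x ∂P, ‖x‖ ≤ r) :
    batchVar P N b = sampleVar P / ((N * b : ℕ) : ℝ) := by
  have hB : ((N * b : ℕ) : ℝ) ≠ 0 := by positivity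
  have hs : ∀ k l, Integrable (fun x : Vec d => (outer x k l - covMat P k l) ^ 2) P :=
    fun k l => ((memLp_outer hbound k l 2).sub (memLp_const (covMat P k l))).integrable_sq
  have hsum : batchVar P N b = ∑ k, ∑ l, ∫ y : Fin N × Fin b → Vec d, batchErr P y k l ^ 2
      ∂(Measure.pi fun _ => P) := by
    unfold batchVar frobSq
    rw [integral_finsetSum _ fun k _ => integrable_finsetSum _ fun l _ =>
      integrable_batchErr_sq hbound k l]
    exact Finset.sum_congr rfl fun k _ =>
      integral_finsetSum _ fun l _ => integrable_batchErr_sq hbound k l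
  have hsum' : sampleVar P = ∑ k, ∑ l, ∫ x, (outer x k l - covMat P k l) ^ 2 ∂P := by
    unfold sampleVar frobSq
    simp only [Matrix.sub_apply]
    rw [integral_finsetSum _ fun k _ => integrable_finsetSum _ fun l _ => hs k l]
    exact Finset.sum_congr rfl fun k _ => integral_finsetSum _ fun l _ => hs k l
  rw [hsum, hsum', Finset.sum_div]
  refine Finset.sum_congr rfl fun k _ => ?_
  rw [Finset.sum_div]
  refine Finset.sum_congr rfl fun l _ => ?_
  set X : Vec d → ℝ := fun x => outer x k l
  have hXm : MemLp X 2 P := memLp_outer hbound k l 2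
  have hvar : Var[X; P] = ∫ x, (outer x k l - covMat P k l) ^ 2 ∂P := by
    rw [variance_eq_integral (measurable_outer k l).aemeasurable]
    rfl
  -- Entry by entry, variances of independent samples add up, while the prefactor contributes
  -- `1/B²`.
  have h1 := variance_sum_pi (μ := fun _ : Fin N × Fin b => P) (X := fun _ => X) (fun _ => hXm)
  rw [Finset.sum_const, Finset.card_univ, Fintype.card_prod, Fintype.card_fin, Fintype.card_fin,
    nsmul_eq_mul, hvar] at h1
  have h2 := variance_eq_integral (μ := Measure.pi fun _ : Fin N × Fin b => P)
    (X := fun y => (1 / ((N * b : ℕ) : ℝ)) * ∑ p : Fin N × Fin b, X (y p))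
    (by
      refine (Measurable.const_mul (Finset.measurable_fun_sum _ fun p _ => ?_) _).aemeasurable
      exact (measurable_outer k l).comp (measurable_pi_apply p))
  have h3 : ∫ y : Fin N × Fin b → Vec d, (1 / ((N * b : ℕ) : ℝ)) * ∑ p : Fin N × Fin b, X (y p)
      ∂(Measure.pi fun _ => P) = covMat P k l := by
    rw [integral_const_mul, integral_finsetSum _ fun p _ =>
      memLp_one_iff_integrable.1 (memLp_outer_eval hbound k l p 1)]
    simp only [integral_outer_eval]
    simp only [Finset.sum_const, Finset.card_univ, Fintype.card_prod, Fintype.card_fin,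
      nsmul_eq_mul]
    field_simp
  rw [h3, variance_const_mul] at h2
  have h4 : ∀ y : Fin N × Fin b → Vec d, batchErr P y k l =
      (1 / ((N * b : ℕ) : ℝ)) * ∑ p : Fin N × Fin b, X (y p) - covMat P k l := fun y => by
    rw [batchErr, Matrix.sub_apply, batchCov_apply]
  simp only [h4]
  rw [← h2]
  have h5 : (fun y : Fin N × Fin b → Vec d => ∑ p, X (y p)) = ∑ p, fun y => X (y p) := by
    ext y; simp
  rw [h5, h1]
  field_simp

end Batch

/-! ### One random step in expectation. -/

section OneStep

variable {d N b : ℕ} {P : Measure (Vec d)} [IsProbabilityMeasure P] {r : ℝ}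

theorem one_le_secSq {q v : Vec d} (hq : ‖q‖ = 1) (hv : inner ℝ v q ≠ (0 : ℝ)) :
    1 ≤ secSq q v := by
  have h := abs_real_inner_le_norm v q
  rw [hq, mul_one] at h
  rw [secSq, le_div_iff₀ (by positivity), one_mul, ← sq_abs]
  exact pow_le_pow_left₀ (abs_nonneg _) h 2

/-- One step from a unit vector, with the samples bounded by `r`. -/
theorem secSq_step_unit (hd : 2 ≤ d) (hN : 0 < N) (hb : 0 < b)
    (hbound : ∀ᵐ x ∂P, ‖x‖ ≤ r) (hgap : secondEig hd P < topEig hd P)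
    {q : Vec d} (hq : ‖q‖ = 1) (hqeig : matOp (covMat P) q = topEig hd P • q)
    {γ ε : ℝ} (hγ : 0 ≤ γ) (hε : 0 < ε) (hsmall : (10 * γ * r ^ 2) ^ 2 ≤ ε)
    {u : Vec d} (hu : ‖u‖ = 1) (hw : inner ℝ u q ≠ (0 : ℝ)) (hR : secSq q u ≤ 1 / ε) :
    ∃ z : Vec d, ∀ y : Fin N × Fin b → Vec d, (∀ p, ‖y p‖ ≤ r) →
      1 ≤ secSq q (krasulinaStep γ (matOp (batchCov fun i j => y (i, j))) u) ∧
      secSq q (krasulinaStep γ (matOp (batchCov fun i j => y (i, j))) u) - 1 ≤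
        (secSq q u - 1) *
            (1 - 2 * γ * (topEig hd P - secondEig hd P) + 6 * γ ^ 2 * topEig hd P ^ 2) +
          inner ℝ z (matOp (batchErr P y) u) +
          γ ^ 2 * secSq q u * (4 * (secSq q u - 1) + 1.3) * frobSq (batchErr P y) := by
  obtain ⟨h1, h2, h3, h4⟩ := spectral_facts hd hbound hgap hq hqeig hu
  have hΨ := norm_sq_sub_inner_smul hu q
  rw [hq, one_pow] at hΨ
  set S := matOp (covMat P)
  set l₁ := topEig hd P
  set w : ℝ := inner ℝ u q
  have hΨ0 : 0 ≤ 1 - w ^ 2 := by rw [← hΨ]; positivity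
  have hlow0 : 0 ≤ l₁ - inner ℝ u (S u) := by
    refine le_trans ?_ h2
    exact mul_nonneg (by linarith) hΨ0
  have hwε : ε ≤ w ^ 2 := by
    have : secSq q u = 1 / w ^ 2 := by rw [secSq, hu, one_pow]
    rw [this] at hR
    exact (one_div_le_one_div (by positivity) hε).1 hR
  -- The vector `z` depends on `u` but not on the batch `y`, so the linear term will integrate to
  -- zero.
  refine ⟨secSq q u • (((-2 * γ + 8 * γ ^ 2 * (l₁ - inner ℝ u (S u))) / w) • (q - w • u) +
    (2.6 * γ ^ 2) • (S u - (inner ℝ u (S u) : ℝ) • u)), fun y hy => ?_⟩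
  have hA : matOp (batchCov fun i j => y (i, j)) = S + matOp (batchErr P y) := by
    rw [← map_add]; simp [batchErr]
  have hη : |γ * ((l₁ - inner ℝ u (S u)) +
      inner ℝ (q - w • u) (matOp (batchErr P y) u) / w)| ≤ 1 / 10 := by
    -- Drift and noise recombine into the whole sample covariance, whose operator norm is at most
    -- `r²`; hence `|γη| ≤ γr²/|w|`, and `|w| ≥ √ε ≥ 10γr²`.
    have hh : (l₁ - inner ℝ u (S u)) + inner ℝ (q - w • u) (matOp (batchErr P y) u) / w =
        inner ℝ (q - w • u) (matOp (batchCov fun i j => y (i, j)) u) / w := by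
      rw [hA, LinearMap.add_apply, inner_add_right]
      have : inner ℝ (q - w • u) (S u) = w * (l₁ - inner ℝ u (S u)) := by
        rw [inner_sub_left, inner_smul_left, h1]; simp only [conj_trivial]; ring
      rw [this]
      field_simp
    rw [hh]
    have hA' := norm_matOp_batchCov_le hN hb (y := fun i j => y (i, j)) (fun i j => hy (i, j)) u
    rw [hu, mul_one] at hA'
    have h5 := abs_real_inner_le_norm (q - w • u) (matOp (batchCov fun i j => y (i, j)) u)
    have h6 : ‖q - w • u‖ ≤ 1 := by nlinarith [norm_nonneg (q - w • u), sq_nonneg w]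
    have h7 : |inner ℝ (q - w • u) (matOp (batchCov fun i j => y (i, j)) u)| ≤ r ^ 2 :=
      h5.trans (by nlinarith [norm_nonneg (q - w • u),
        norm_nonneg (matOp (batchCov fun i j => y (i, j)) u), sq_nonneg r])
    have h8 : 10 * γ * r ^ 2 ≤ |w| := by
      refine abs_le_of_sq_le_sq' ?_ (abs_nonneg _) |>.2
      rw [sq_abs]; exact hsmall.trans hwε
    rw [abs_mul, abs_div, abs_of_nonneg hγ, mul_div_assoc', div_le_iff₀ (abs_pos.2 hw)]
    nlinarith [mul_le_mul_of_nonneg_left h7 hγ]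
  rw [hA]
  constructor
  · refine one_le_secSq hq ?_
    rw [inner_krasulinaStep hu S _ γ hw h1]
    refine mul_ne_zero hw ?_
    have := (abs_le.1 hη).1
    intro h0
    linarith
  · exact secSq_krasulinaStep_le hu hq S (matOp (batchErr P y)) hγ hw h1 h2 hlow0 h3 h4
      (by simpa [hu] using norm_matOp_sq_le (batchErr P y) u) hη

/-- One step in expectation: `tan²` of the angle to the top eigenvector contracts up to an additive
term of the order of the variance of the mini-batch. -/
theorem lintegral_secSq_step_le (hd : 2 ≤ d) (hN : 0 < N) (hb : 0 < b)
    (hbound : ∀ᵐ x ∂P, ‖x‖ ≤ r) (hgap : secondEig hd P < topEig hd P)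
    {q : Vec d} (hq : ‖q‖ = 1) (hqeig : matOp (covMat P) q = topEig hd P • q)
    {γ ε : ℝ} (hγ : 0 ≤ γ) (hε : 0 < ε) (hsmall : (10 * γ * r ^ 2) ^ 2 ≤ ε)
    {v : Vec d} (hw : inner ℝ v q ≠ (0 : ℝ)) (hR : secSq q v ≤ 1 / ε) :
    ∫⁻ y : Fin N × Fin b → Vec d,
        ENNReal.ofReal (secSq q (krasulinaStep γ (matOp (batchCov fun i j => y (i, j))) v) - 1)
        ∂(Measure.pi fun _ => P) ≤
      ENNReal.ofReal ((secSq q v - 1) * (1 - 2 * γ * (topEig hd P - secondEig hd P) +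
          γ ^ 2 * (6 * topEig hd P ^ 2 + 6 * batchVar P N b / ε)) +
        2 * γ ^ 2 * batchVar P N b) ∧
    ∀ᵐ y ∂(Measure.pi fun _ : Fin N × Fin b => P),
      1 ≤ secSq q (krasulinaStep γ (matOp (batchCov fun i j => y (i, j))) v) := by
  have hv : v ≠ 0 := by rintro rfl; simp at hw
  have hv' : ‖v‖ ≠ 0 := norm_ne_zero_iff.2 hv
  set u : Vec d := ‖v‖⁻¹ • v with hu_def
  have hvu : v = ‖v‖ • u := by rw [hu_def, smul_smul, mul_inv_cancel₀ hv', one_smul]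
  have hu : ‖u‖ = 1 := by rw [hu_def, norm_smul, norm_inv, norm_norm, inv_mul_cancel₀ hv']
  have hsec : secSq q v = secSq q u := by rw [hvu]; exact secSq_smul q u hv'
  have hwu : inner ℝ u q ≠ (0 : ℝ) := by
    rw [hu_def, inner_smul_left]
    exact mul_ne_zero (by simpa using hv) hw
  have hstep : ∀ A : Vec d →ₗ[ℝ] Vec d,
      secSq q (krasulinaStep γ A v) = secSq q (krasulinaStep γ A u) := fun A => by
    rw [hvu, krasulinaStep_smul γ A u hv', secSq_smul q _ hv']
  have hR1 : 1 ≤ secSq q u := one_le_secSq hq hwu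
  rw [hsec] at hR ⊢
  simp only [hstep]
  obtain ⟨z, hz⟩ := secSq_step_unit (N := N) (b := b) hd hN hb hbound hgap hq hqeig hγ hε hsmall
    hu hwu hR
  set R := secSq q u
  set a : ℝ := (R - 1) *
    (1 - 2 * γ * (topEig hd P - secondEig hd P) + 6 * γ ^ 2 * topEig hd P ^ 2) with ha
  set k : ℝ := γ ^ 2 * R * (4 * (R - 1) + 1.3) with hk
  clear_value a k
  have hae := ae_pi_norm_le (N := N) (b := b) hbound
  refine ⟨?_, by filter_upwards [hae] with y hy using (hz y hy).1⟩
  have hlinint : Integrable (fun y : Fin N × Fin b → Vec d => inner ℝ z (matOp (batchErr P y) u))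
      (Measure.pi fun _ => P) := by
    simp only [inner_matOp]
    exact integrable_finsetSum _ fun i _ => integrable_finsetSum _ fun j _ =>
      (memLp_one_iff_integrable.1 (memLp_batchErr hbound i j 1)).const_mul _
  have hlin0 : ∫ y : Fin N × Fin b → Vec d, inner ℝ z (matOp (batchErr P y) u)
      ∂(Measure.pi fun _ => P) = 0 := by
    simp only [inner_matOp]
    rw [integral_finsetSum _ fun i _ => integrable_finsetSum _ fun j _ =>
      (memLp_one_iff_integrable.1 (memLp_batchErr hbound i j 1)).const_mul _]
    refine Finset.sum_eq_zero fun i _ => ?_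
    rw [integral_finsetSum _ fun j _ =>
      (memLp_one_iff_integrable.1 (memLp_batchErr hbound i j 1)).const_mul _]
    refine Finset.sum_eq_zero fun j _ => ?_
    rw [integral_const_mul, integral_batchErr hN hb hbound, mul_zero]
  have hFint := integrable_frobSq_batchErr (N := N) (b := b) hbound
  have hint : Integrable (fun y : Fin N × Fin b → Vec d =>
      a + inner ℝ z (matOp (batchErr P y) u) + k * frobSq (batchErr P y))
      (Measure.pi fun _ => P) := ((integrable_const a).add hlinint).add (hFint.const_mul k)
  have hval : ∫ y : Fin N × Fin b → Vec d,
      (a + inner ℝ z (matOp (batchErr P y) u) + k * frobSq (batchErr P y))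
      ∂(Measure.pi fun _ => P) = a + k * batchVar P N b := by
    have e1 := integral_add ((integrable_const a).add hlinint) (hFint.const_mul k)
    simp only [Pi.add_apply] at e1
    rw [e1, integral_add (integrable_const a) hlinint, hlin0, integral_const_mul k, integral_const]
    simp [batchVar]
  calc _ ≤ ∫⁻ y : Fin N × Fin b → Vec d, ENNReal.ofReal
        (a + inner ℝ z (matOp (batchErr P y) u) + k * frobSq (batchErr P y))
        ∂(Measure.pi fun _ => P) := by
        refine lintegral_mono_ae ?_
        filter_upwards [hae] with y hy using ENNReal.ofReal_le_ofReal (hz y hy).2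
    _ = ENNReal.ofReal (a + k * batchVar P N b) := by
        -- The integrand is nonnegative almost surely because it dominates `sec² - 1 ≥ 0`.
        rw [← hval, ofReal_integral_eq_lintegral_ofReal hint]
        filter_upwards [hae] with y hy
        have := hz y hy
        simp only [Pi.zero_apply]
        linarith [this.1, this.2]
    _ ≤ _ := by
        refine ENNReal.ofReal_le_ofReal ?_
        have hV := batchVar_nonneg P N b
        have h1ε : 1 ≤ 1 / ε := hR1.trans hR
        -- One factor `R ≤ 1/ε` is given up so that the noise becomes affine in `tan² = R - 1`:
        -- `R(4(R-1) + 1.3) ≤ 5.3(R-1)/ε + 1.3`.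
        have hkle : k ≤ γ ^ 2 * ((R - 1) * (6 * (1 / ε)) + 2) := by
          rw [hk, mul_assoc]
          apply mul_le_mul_of_nonneg_left _ (sq_nonneg _)
          nlinarith
        have := mul_le_mul_of_nonneg_right hkle hV
        rw [ha]
        have e : 6 * batchVar P N b / ε = 6 * (1 / ε) * batchVar P N b := by ring
        rw [e]
        linarith

end OneStep

/-! ### Anti-concentration of a uniform direction. -/

section Sphere

variable {d : ℕ}

theorem lintegral_gaussian_basis (e : OrthonormalBasis (Fin d) ℝ (Vec d)) {β : Fin d → ℝ}
    (hβ : ∀ i, 0 < β i) :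
    ∫⁻ x : Vec d, ENNReal.ofReal (Real.exp (-∑ i, β i * (inner ℝ (e i) x : ℝ) ^ 2)) =
      ENNReal.ofReal (∏ i, √(Real.pi / β i)) := by
  have h1 : ∫⁻ x : Vec d, ENNReal.ofReal (Real.exp (-∑ i, β i * (inner ℝ (e i) x : ℝ) ^ 2)) =
      ∫⁻ x : Vec d, ENNReal.ofReal (Real.exp (-∑ i, β i * (x i) ^ 2)) := by
    rw [← e.measurePreserving_repr.lintegral_comp_emb e.repr.toHomeomorph.measurableEmbedding
      (fun x : Vec d => ENNReal.ofReal (Real.exp (-∑ i, β i * (x i) ^ 2)))]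
    simp only [OrthonormalBasis.repr_apply_apply]
  have h2 : ∫⁻ x : Vec d, ENNReal.ofReal (Real.exp (-∑ i, β i * (x i) ^ 2)) =
      ∫⁻ x : Fin d → ℝ, ENNReal.ofReal (Real.exp (-∑ i, β i * (x i) ^ 2)) := by
    rw [← (PiLp.volume_preserving_ofLp (Fin d)).lintegral_comp_emb
      (MeasurableEquiv.toLp 2 (Fin d → ℝ)).symm.measurableEmbedding
      (fun x : Fin d → ℝ => ENNReal.ofReal (Real.exp (-∑ i, β i * (x i) ^ 2)))]
  have h3 : ∀ x : Fin d → ℝ, Real.exp (-∑ i, β i * (x i) ^ 2) =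
      ∏ i, Real.exp (-(β i) * (x i) ^ 2) := fun x => by
    rw [← Real.exp_sum, ← Finset.sum_neg_distrib]
    simp only [neg_mul]
  rw [h1, h2]
  simp only [h3]
  have hint : Integrable (fun x : Fin d → ℝ => ∏ i, Real.exp (-(β i) * (x i) ^ 2)) :=
    Integrable.fintype_prod fun i => integrable_exp_neg_mul_sq (hβ i)
  rw [← ofReal_integral_eq_lintegral_ofReal hint
    (.of_forall fun x => Finset.prod_nonneg fun i _ => (Real.exp_pos _).le),
    integral_fintype_prod_volume_eq_prod (fun i (t : ℝ) => Real.exp (-(β i) * t ^ 2))]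
  simp only [integral_gaussian]

theorem exists_basis_extending (hd : 0 < d) {q : Vec d} (hq : ‖q‖ = 1) :
    ∃ e : OrthonormalBasis (Fin d) ℝ (Vec d), e ⟨0, hd⟩ = q := by
  have h : Orthonormal ℝ (({⟨0, hd⟩} : Set (Fin d)).domRestrict fun _ : Fin d => q) := by
    constructor
    · intro i; exact hq
    · intro i j hij
      exact absurd (Subsingleton.elim i j) hij
  obtain ⟨e, he⟩ := h.exists_orthonormalBasis_extension_of_card_eq (by simp)
  exact ⟨e, he _ rfl⟩

/-- Polar coordinates for a radial weight on a cone. -/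
theorem lintegral_cone {K : Set (Vec d)} (hK : MeasurableSet K)
    (hcone : ∀ (a : ℝ) (x : Vec d), 0 < a → (a • x ∈ K ↔ x ∈ K)) :
    ∫⁻ x in K, ENNReal.ofReal (Real.exp (-‖x‖ ^ 2)) ∂(volume : Measure (Vec d)).restrict {0}ᶜ =
      (volume : Measure (Vec d)).toSphere (Subtype.val ⁻¹' K) *
        ∫⁻ ρ : Set.Ioi (0 : ℝ), ENNReal.ofReal (Real.exp (-(ρ : ℝ) ^ 2))
          ∂(Measure.volumeIoiPow (Module.finrank ℝ (Vec d) - 1)) := by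
  rw [← lintegral_indicator hK, ← lintegral_subtype_comap (measurableSet_singleton _).compl]
  set μ : Measure (Vec d) := volume
  have h := μ.measurePreserving_homeomorphUnitSphereProd.lintegral_comp_emb
    (Homeomorph.measurableEmbedding _)
    (fun p => (Subtype.val ⁻¹' K).indicator (fun _ => (1 : ENNReal)) p.1 *
      ENNReal.ofReal (Real.exp (-(p.2 : ℝ) ^ 2)))
  rw [lintegral_prod_mul (μ := μ.toSphere)
    (f := (Subtype.val ⁻¹' K).indicator (fun _ => (1 : ENNReal)))
    (g := fun ρ : Set.Ioi (0 : ℝ) => ENNReal.ofReal (Real.exp (-(ρ : ℝ) ^ 2)))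
    ((measurable_const.indicator (measurable_subtype_coe hK)).aemeasurable)
    (by fun_prop), lintegral_indicator (measurable_subtype_coe hK)] at h
  simp only [lintegral_const, Measure.restrict_apply_univ, one_mul] at h
  rw [← h]
  refine lintegral_congr fun x => ?_
  have hx : 0 < ‖(x : Vec d)‖⁻¹ := inv_pos.2 (norm_pos_iff.2 x.2)
  by_cases hxK : (x : Vec d) ∈ K
  · have : (homeomorphUnitSphereProd (Vec d) x).1 ∈ (Subtype.val ⁻¹' K : Set _) := by
      rw [Set.mem_preimage, homeomorphUnitSphereProd_apply_fst_coe]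
      exact (hcone _ _ hx).2 hxK
    rw [Set.indicator_of_mem hxK, Set.indicator_of_mem this, one_mul]
    simp
  · have : (homeomorphUnitSphereProd (Vec d) x).1 ∉ (Subtype.val ⁻¹' K : Set _) := by
      rw [Set.mem_preimage, homeomorphUnitSphereProd_apply_fst_coe]
      exact fun h => hxK ((hcone _ _ hx).1 h)
    rw [Set.indicator_of_notMem hxK, Set.indicator_of_notMem this, zero_mul]

/-- The direction `i₀` gains the factor `√(dη)`; each of the other `d - 1` loses `√(1 + 1/(d-1)) ≤
√(exp (1/(d-1)))`, altogether `√e`. -/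
theorem prod_sqrt_pi_div_le (hd : 2 ≤ d) {η : ℝ} (hη : 0 < η) (i₀ : Fin d) :
    ∏ i, √(Real.pi / (1 - 1 / (d : ℝ) + if i = i₀ then 1 / (d * η) else 0)) ≤
      √(Real.exp 1 * d * η) * ∏ _i : Fin d, √(Real.pi / 1) := by
  have hd' : (2 : ℝ) ≤ d := by exact_mod_cast hd
  have hd1 : (0 : ℝ) < d - 1 := by linarith
  have hπ := Real.pi_pos
  rw [← Finset.mul_prod_erase _ _ (Finset.mem_univ i₀),
    ← Finset.mul_prod_erase _ (fun _ : Fin d => √(Real.pi / 1)) (Finset.mem_univ i₀)]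
  have h0 : √(Real.pi / (1 - 1 / (d : ℝ) + if i₀ = i₀ then 1 / (d * η) else 0)) ≤
      √(d * η) * √(Real.pi / 1) := by
    rw [← Real.sqrt_mul (by positivity), if_pos rfl]
    apply Real.sqrt_le_sqrt
    have h1 : 1 / (d * η) ≤ 1 - 1 / (d : ℝ) + 1 / (d * η) := by
      have : 1 / (d : ℝ) ≤ 1 := by rw [div_le_one (by linarith)]; linarith
      linarith
    calc Real.pi / (1 - 1 / (d : ℝ) + 1 / (d * η)) ≤ Real.pi / (1 / (d * η)) := by gcongr
      _ = d * η * (Real.pi / 1) := by field_simp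
  have h1 : ∏ i ∈ Finset.univ.erase i₀,
        √(Real.pi / (1 - 1 / (d : ℝ) + if i = i₀ then 1 / (d * η) else 0)) ≤
      √(Real.exp 1) * ∏ _i ∈ Finset.univ.erase i₀, √(Real.pi / 1) := by
    have hc : ∀ i ∈ Finset.univ.erase i₀,
        √(Real.pi / (1 - 1 / (d : ℝ) + if i = i₀ then 1 / (d * η) else 0)) ≤
          √(Real.exp (1 / (d - 1))) * √(Real.pi / 1) := fun i hi => by
      rw [if_neg (Finset.ne_of_mem_erase hi), add_zero, ← Real.sqrt_mul (by positivity)]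
      apply Real.sqrt_le_sqrt
      have h2 : 1 / (1 - 1 / (d : ℝ)) = 1 / (d - 1) + 1 := by
        have : (d : ℝ) - 1 ≠ 0 := hd1.ne'
        field_simp
        ring
      calc Real.pi / (1 - 1 / (d : ℝ)) = 1 / (1 - 1 / (d : ℝ)) * (Real.pi / 1) := by ring
        _ ≤ _ := by
          rw [h2]
          exact mul_le_mul_of_nonneg_right (Real.add_one_le_exp _) (by positivity)
    refine (Finset.prod_le_prod (fun i _ => Real.sqrt_nonneg _) hc).trans ?_
    rw [Finset.prod_mul_distrib]
    apply mul_le_mul_of_nonneg_right _ (Finset.prod_nonneg fun _ _ => Real.sqrt_nonneg _)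
    rw [Finset.prod_const, Finset.card_erase_of_mem (Finset.mem_univ _), Finset.card_univ,
      Fintype.card_fin]
    refine Real.le_sqrt_of_sq_le ?_
    rw [← pow_mul, mul_comm, pow_mul, Real.sq_sqrt (Real.exp_pos _).le, ← Real.exp_nat_mul,
      Nat.cast_sub (by omega), Nat.cast_one, mul_one_div_cancel hd1.ne']
  calc _ ≤ (√(d * η) * √(Real.pi / 1)) *
        (√(Real.exp 1) * ∏ _i ∈ Finset.univ.erase i₀, √(Real.pi / 1)) :=
        mul_le_mul h0 h1 (Finset.prod_nonneg fun _ _ => Real.sqrt_nonneg _) (by positivity)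
    _ = _ := by
        rw [mul_assoc (Real.exp 1), Real.sqrt_mul (Real.exp_pos 1).le]
        ring

/-- A uniformly random direction is rarely almost orthogonal to a fixed one. -/
theorem sphereUniform_cone_le (hd : 2 ≤ d) {q : Vec d} (hq : ‖q‖ = 1) {η : ℝ} (hη : 0 < η) :
    sphereUniform d {x | (inner ℝ x q : ℝ) ^ 2 ≤ η * ‖x‖ ^ 2} ≤
      ENNReal.ofReal (√(Real.exp 1 * d * η)) := by
  have hd0 : 0 < d := by omega
  have hd' : (2 : ℝ) ≤ d := by exact_mod_cast hd
  have : Nontrivial (Vec d) := by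
    refine ⟨q, 0, fun h => ?_⟩
    rw [h] at hq; simp at hq
  set K : Set (Vec d) := {x | (inner ℝ x q : ℝ) ^ 2 ≤ η * ‖x‖ ^ 2} with hKdef
  have hK : MeasurableSet K := measurableSet_le (by fun_prop) (by fun_prop)
  have hcone : ∀ (a : ℝ) (x : Vec d), 0 < a → (a • x ∈ K ↔ x ∈ K) := fun a x ha => by
    simp only [hKdef, Set.mem_ofPred_eq, inner_smul_left, norm_smul, mul_pow, conj_trivial,
      Real.norm_eq_abs, sq_abs]
    rw [show η * (a ^ 2 * ‖x‖ ^ 2) = a ^ 2 * (η * ‖x‖ ^ 2) by ring]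
    exact mul_le_mul_iff_right₀ (by positivity)
  obtain ⟨e, he⟩ := exists_basis_extending hd0 hq
  set i₀ : Fin d := ⟨0, hd0⟩
  have hnorm : ∀ x : Vec d, ‖x‖ ^ 2 = ∑ i, (inner ℝ (e i) x : ℝ) ^ 2 := fun x => by
    rw [← e.sum_sq_norm_inner_right x]; simp
  -- The Gaussian masses of the cone and of the whole space contain the same radial integral, so
  -- their ratio is the spherical measure of the cone.
  have hI := lintegral_cone hK hcone
  have hU := lintegral_cone (K := (Set.univ : Set (Vec d))) .univ (by simp)
  rw [Set.preimage_univ, Measure.restrict_univ, restrict_compl_singleton] at hU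
  rw [restrict_compl_singleton] at hI
  set τ : Measure (Metric.sphere (0 : Vec d) 1) := (volume : Measure (Vec d)).toSphere
  set I := ∫⁻ ρ : Set.Ioi (0 : ℝ), ENNReal.ofReal (Real.exp (-(ρ : ℝ) ^ 2))
          ∂(Measure.volumeIoiPow (Module.finrank ℝ (Vec d) - 1))
  have hZ : ∫⁻ x : Vec d, ENNReal.ofReal (Real.exp (-‖x‖ ^ 2)) =
      ENNReal.ofReal (∏ _i : Fin d, √(Real.pi / 1)) := by
    rw [← lintegral_gaussian_basis e (β := fun _ => 1) (fun _ => one_pos)]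
    simp only [hnorm, one_mul]
  have hA : ∫⁻ x in K, ENNReal.ofReal (Real.exp (-‖x‖ ^ 2)) ≤
      ENNReal.ofReal (∏ i, √(Real.pi / (1 - 1 / (d : ℝ) + if i = i₀ then 1 / (d * η) else 0))) := by
    have hβ : ∀ i, 0 < 1 - 1 / (d : ℝ) + if i = i₀ then 1 / (d * η) else 0 := fun i => by
      have h1 : 1 / (d : ℝ) < 1 := by rw [div_lt_one (by linarith)]; linarith
      have h2 : (0 : ℝ) ≤ if i = i₀ then 1 / (d * η) else 0 := by split_ifs <;> positivity
      linarith
    rw [← lintegral_gaussian_basis e hβ]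
    refine le_trans ?_ (setLIntegral_le_lintegral K _)
    -- Exponential tilting: on the cone, `(1 - 1/d)‖x‖² + ⟨x, q⟩²/(dη) ≤ ‖x‖²`, so the tilted
    -- Gaussian dominates there and can be integrated over the whole space.
    refine setLIntegral_mono' hK fun x hx => ENNReal.ofReal_le_ofReal (Real.exp_le_exp.2 ?_)
    have h1 : ∑ i, (1 - 1 / (d : ℝ) + if i = i₀ then 1 / (d * η) else 0) *
        (inner ℝ (e i) x : ℝ) ^ 2 = (1 - 1 / (d : ℝ)) * ‖x‖ ^ 2 +
          1 / (d * η) * (inner ℝ x q : ℝ) ^ 2 := by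
      rw [hnorm, Finset.mul_sum]
      simp only [add_mul, Finset.sum_add_distrib, ite_mul, zero_mul, Finset.sum_ite_eq',
        Finset.mem_univ, if_true]
      rw [he, real_inner_comm]
    rw [h1]
    have h2 : 1 / (d * η) * (inner ℝ x q : ℝ) ^ 2 ≤ 1 / (d : ℝ) * ‖x‖ ^ 2 := by
      calc 1 / (d * η) * (inner ℝ x q : ℝ) ^ 2 ≤ 1 / (d * η) * (η * ‖x‖ ^ 2) :=
            mul_le_mul_of_nonneg_left hx (by positivity)
        _ = _ := by field_simp
    linarith
  have hτ0 : τ Set.univ ≠ 0 := by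
    rw [Ne, Measure.measure_univ_eq_zero]
    exact Measure.toSphere_ne_zero _
  have hτt : τ Set.univ ≠ ⊤ := measure_ne_top _ _
  have hI0 : I ≠ 0 := by
    intro h0
    rw [hZ, h0, mul_zero, ENNReal.ofReal_eq_zero] at hU
    have : 0 < ∏ _i : Fin d, √(Real.pi / 1) :=
      Finset.prod_pos fun _ _ => Real.sqrt_pos.2 (by positivity)
    linarith
  have hIt : I ≠ ⊤ := by
    intro h0
    rw [hZ, h0, ENNReal.mul_top hτ0] at hU
    exact ENNReal.ofReal_ne_top hU
  have hmain : τ (Subtype.val ⁻¹' K) * I ≤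
      ENNReal.ofReal (√(Real.exp 1 * d * η)) * τ Set.univ * I := by
    rw [← hI, mul_assoc, ← hU, hZ, ← ENNReal.ofReal_mul (Real.sqrt_nonneg _)]
    exact hA.trans (ENNReal.ofReal_le_ofReal (prod_sqrt_pi_div_le hd hη i₀))
  rw [ENNReal.mul_le_mul_iff_left hI0 hIt] at hmain
  rw [sphereUniform, Measure.map_apply measurable_subtype_coe hK, Measure.smul_apply, smul_eq_mul]
  calc _ ≤ (τ Set.univ)⁻¹ * (ENNReal.ofReal (√(Real.exp 1 * d * η)) * τ Set.univ) := by gcongr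
    _ = _ := by
      rw [mul_comm, mul_assoc, ENNReal.mul_inv_cancel hτ0 hτt, mul_one]

end Sphere

/-! ### Measurability of the iterates. -/

section Measurability

variable {d N b : ℕ}

theorem measurable_matOp :
    Measurable fun p : (Fin d → Fin d → ℝ) × Vec d => matOp (Matrix.of p.1) p.2 := by
  have : (fun p : (Fin d → Fin d → ℝ) × Vec d => matOp (Matrix.of p.1) p.2) =
      fun p => WithLp.toLp 2 fun i => ∑ j, p.1 i j * p.2 j := by
    ext p i
    rw [matOp_apply]
    rfl
  rw [this]
  fun_prop

theorem measurable_krasulinaStep (γ : ℝ) :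
    Measurable fun p : (Fin d → Fin d → ℝ) × Vec d =>
      krasulinaStep γ (matOp (Matrix.of p.1)) p.2 := by
  have h := measurable_matOp (d := d)
  unfold krasulinaStep
  exact measurable_snd.add ((h.sub (((measurable_snd.inner h).div
    (measurable_snd.norm.pow_const 2)).smul measurable_snd)).const_smul γ)

theorem measurable_batchCov :
    Measurable fun (y : Fin N → Fin b → Vec d) (k l : Fin d) => batchCov y k l := by
  refine measurable_pi_iff.2 fun k => measurable_pi_iff.2 fun l => ?_
  have : (fun y : Fin N → Fin b → Vec d => batchCov y k l) = fun y =>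
      (1 / ((N * b : ℕ) : ℝ)) * ∑ i, ∑ j, outer (y i j) k l := by
    ext y
    rw [batchCov, Matrix.smul_apply, smul_eq_mul, Matrix.sum_apply]
    simp only [Matrix.sum_apply]
  rw [this]
  refine (Finset.measurable_fun_sum _ fun i _ => Finset.measurable_fun_sum _ fun j _ => ?_).const_mul _
  exact (measurable_outer k l).comp ((measurable_pi_apply j).comp (measurable_pi_apply i))

theorem measurable_dmk (γ : ℕ → ℝ) (t : ℕ) :
    Measurable fun p : Vec d × (ℕ → Fin N → Fin b → Vec d) => dmk γ p.1 p.2 t := by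
  induction t with
  | zero => exact measurable_fst
  | succ t ih =>
    simp only [dmk_succ]
    exact (measurable_krasulinaStep (γ (t + 1))).comp
      ((measurable_batchCov.comp ((measurable_pi_apply t).comp measurable_snd)).prodMk ih)

theorem dmk_congr (γ : ℕ → ℝ) (v : Vec d) {y y' : ℕ → Fin N → Fin b → Vec d} {t : ℕ}
    (h : ∀ s < t, y s = y' s) : dmk γ v y t = dmk γ v y' t := by
  induction t with
  | zero => rfl
  | succ t ih =>
    rw [dmk_succ, dmk_succ, ih fun s hs => h s (hs.trans (Nat.lt_succ_self t)),
      h t (Nat.lt_succ_self t)]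

theorem measurable_potential (q : Vec d) : Measurable (potential q) := by
  unfold potential
  fun_prop

theorem measurable_secSq (q : Vec d) : Measurable (secSq q) := by
  unfold secSq
  fun_prop

end Measurability

/-! ### Translation between `Ψ` and `tan²`. -/

section Potential

variable {d : ℕ}

/-- The squared tangent of the angle between `v` and `q`, infinite for orthogonal vectors. -/
noncomputable def tanSq (q v : Vec d) : ENNReal :=
  open Classical in if inner ℝ v q = (0 : ℝ) then ⊤ else ENNReal.ofReal (secSq q v - 1)

theorem measurable_tanSq (q : Vec d) : Measurable (tanSq q) := by
  unfold tanSq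
  refine Measurable.ite (measurableSet_eq_fun (by fun_prop) measurable_const) measurable_const ?_
  exact ((measurable_secSq q).sub_const 1).ennreal_ofReal

theorem potential_eq (q v : Vec d) : potential q v = 1 - (secSq q v)⁻¹ := by
  rw [potential, secSq, inv_div]

theorem tanSq_of_ne {q v : Vec d} (h : inner ℝ v q ≠ (0 : ℝ)) :
    tanSq q v = ENNReal.ofReal (secSq q v - 1) := if_neg h

theorem potential_nonneg {q : Vec d} (hq : ‖q‖ = 1) (v : Vec d) : 0 ≤ potential q v := by
  have h := abs_real_inner_le_norm v q
  rw [hq, mul_one] at h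
  rw [potential, sub_nonneg]
  refine div_le_one_of_le₀ ?_ (by positivity)
  rw [← sq_abs]
  exact pow_le_pow_left₀ (abs_nonneg _) h 2

/-- This is `sin² ≤ tan²`, through `s + 1/s ≥ 2` for `s = sec²`. -/
theorem ofReal_potential_le_tanSq {q : Vec d} (hq : ‖q‖ = 1) (v : Vec d) :
    ENNReal.ofReal (potential q v) ≤ tanSq q v := by
  by_cases h : inner ℝ v q = (0 : ℝ)
  · rw [tanSq, if_pos h]; exact le_top
  rw [tanSq_of_ne h, potential_eq]
  refine ENNReal.ofReal_le_ofReal ?_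
  have h1 := one_le_secSq hq h
  have h2 : (secSq q v)⁻¹ * secSq q v = 1 := inv_mul_cancel₀ (by linarith)
  have h3 : 0 < (secSq q v)⁻¹ := by positivity
  nlinarith [sq_nonneg (secSq q v - 1)]

theorem of_potential_le {q v : Vec d} {ε : ℝ} (hε : 0 < ε) (h : potential q v ≤ 1 - ε) :
    inner ℝ v q ≠ (0 : ℝ) ∧ secSq q v ≤ 1 / ε := by
  have h1 : ε ≤ (inner ℝ v q : ℝ) ^ 2 / ‖v‖ ^ 2 := by unfold potential at h; linarith
  have h0 : inner ℝ v q ≠ (0 : ℝ) := by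
    intro h0
    rw [h0] at h1
    simp at h1
    linarith
  refine ⟨h0, ?_⟩
  rw [secSq, ← inv_div, ← one_div]
  exact one_div_le_one_div_of_le hε h1

theorem one_add_tanSq_le {q v : Vec d} (hq : ‖q‖ = 1) {ε : ℝ} (hε : 0 < ε)
    (h : potential q v ≤ 1 - ε) : 1 + tanSq q v ≤ ENNReal.ofReal (1 / ε) := by
  obtain ⟨h0, h1⟩ := of_potential_le hε h
  have h2 := one_le_secSq hq h0
  rw [tanSq_of_ne h0, ← ENNReal.ofReal_one, ← ENNReal.ofReal_add zero_le_one (by linarith)]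
  exact ENNReal.ofReal_le_ofReal (by linarith)

/-- The lower bound used at an exit from the good event; the value `⊤` for orthogonal vectors makes
it hold without exception. -/
theorem le_one_add_tanSq {q v : Vec d} (hq : ‖q‖ = 1) {ε : ℝ} (hε : 0 < ε)
    (h : 1 - ε < potential q v) : ENNReal.ofReal (1 / ε) ≤ 1 + tanSq q v := by
  by_cases h0 : inner ℝ v q = (0 : ℝ)
  · rw [tanSq, if_pos h0, add_top]; exact le_top
  have h2 := one_le_secSq hq h0
  rw [tanSq_of_ne h0, ← ENNReal.ofReal_one, ← ENNReal.ofReal_add zero_le_one (by linarith)]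
  refine ENNReal.ofReal_le_ofReal ?_
  rw [potential_eq] at h
  have h3 : (secSq q v)⁻¹ < ε := by linarith
  have := (inv_lt_comm₀ (by linarith) hε).1 h3
  rw [one_div]; linarith

end Potential

/-! ### Two general facts on independence. -/

section Independence

variable {Ω : Type*} [MeasurableSpace Ω] {Pr : Measure Ω} [IsProbabilityMeasure Pr]

/-- The hypotheses make the law of the triple a threefold product, which may be bracketed either
way. -/
theorem IndepFun.prodMk_assoc {α β γ : Type*} [MeasurableSpace α] [MeasurableSpace β]
    [MeasurableSpace γ] {X : Ω → α} {Y : Ω → β} {Z : Ω → γ} (hX : Measurable X)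
    (hY : Measurable Y) (hZ : Measurable Z) (h : IndepFun X (fun ω => (Y ω, Z ω)) Pr)
    (hYZ : IndepFun Y Z Pr) : IndepFun (fun ω => (X ω, Y ω)) Z Pr := by
  have hXY : IndepFun X Y Pr := h.comp measurable_id measurable_fst
  have := Measure.isProbabilityMeasure_map (μ := Pr) hX.aemeasurable
  have := Measure.isProbabilityMeasure_map (μ := Pr) hY.aemeasurable
  have := Measure.isProbabilityMeasure_map (μ := Pr) hZ.aemeasurable
  rw [indepFun_iff_map_prod_eq_prod_map_map (hX.prodMk hY).aemeasurable hZ.aemeasurable,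
    (indepFun_iff_map_prod_eq_prod_map_map hX.aemeasurable hY.aemeasurable).1 hXY]
  have h1 := (indepFun_iff_map_prod_eq_prod_map_map hX.aemeasurable
    (hY.prodMk hZ).aemeasurable).1 h
  rw [(indepFun_iff_map_prod_eq_prod_map_map hY.aemeasurable hZ.aemeasurable).1 hYZ] at h1
  rw [← ((measurePreserving_prodAssoc (Pr.map X) (Pr.map Y) (Pr.map Z)).symm
    MeasurableEquiv.prodAssoc).map_eq, ← h1,
    Measure.map_map MeasurableEquiv.prodAssoc.symm.measurable (hX.prodMk (hY.prodMk hZ))]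
  rfl

/-- Freezing the past `X`: Tonelli on the product law, with an event that `X` decides. It replaces
conditional expectations throughout. -/
theorem IndepFun.lintegral_eq {α β : Type*} [MeasurableSpace α] [MeasurableSpace β]
    {X : Ω → α} {Y : Ω → β} (hX : Measurable X) (hY : Measurable Y) (h : IndepFun X Y Pr)
    {f : α → β → ENNReal} (hf : Measurable (Function.uncurry f)) {C : Set α}
    (hC : MeasurableSet C) :
    ∫⁻ ω in X ⁻¹' C, f (X ω) (Y ω) ∂Pr = ∫⁻ ω in X ⁻¹' C, ∫⁻ y, f (X ω) y ∂(Pr.map Y) ∂Pr := by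
  have := Measure.isProbabilityMeasure_map (μ := Pr) hY.aemeasurable
  have hm := (indepFun_iff_map_prod_eq_prod_map_map hX.aemeasurable hY.aemeasurable).1 h
  have hg : Measurable fun a => ∫⁻ y, f a y ∂(Pr.map Y) := hf.lintegral_prod_right'
  have hF : Measurable fun p : α × β => C.indicator (fun _ => (1 : ENNReal)) p.1 * f p.1 p.2 :=
    ((measurable_const.indicator hC).comp measurable_fst).mul hf
  calc ∫⁻ ω in X ⁻¹' C, f (X ω) (Y ω) ∂Pr
      = ∫⁻ ω, C.indicator (fun _ => (1 : ENNReal)) (X ω) * f (X ω) (Y ω) ∂Pr := by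
        rw [← lintegral_indicator (hX hC)]
        refine lintegral_congr fun ω => ?_
        by_cases hω : X ω ∈ C
        · rw [Set.indicator_of_mem (by exact hω), Set.indicator_of_mem hω, one_mul]
        · rw [Set.indicator_of_notMem (by exact hω), Set.indicator_of_notMem hω, zero_mul]
    _ = ∫⁻ p, C.indicator (fun _ => (1 : ENNReal)) p.1 * f p.1 p.2
          ∂((Pr.map X).prod (Pr.map Y)) := by
        rw [← hm, lintegral_map hF (hX.prodMk hY)]
    _ = ∫⁻ a, C.indicator (fun _ => (1 : ENNReal)) a * ∫⁻ y, f a y ∂(Pr.map Y) ∂(Pr.map X) := by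
        rw [lintegral_prod _ hF.aemeasurable]
        refine lintegral_congr fun a => ?_
        exact lintegral_const_mul (C.indicator (fun _ => 1) a) (hf.comp measurable_prodMk_left)
    _ = _ := by
        rw [lintegral_map (f := fun a => C.indicator (fun _ => (1 : ENNReal)) a *
            ∫⁻ y, f a y ∂(Pr.map Y)) ((measurable_const.indicator hC).mul hg) hX,
          ← lintegral_indicator (hX hC)]
        refine lintegral_congr fun ω => ?_
        by_cases hω : X ω ∈ C
        · rw [Set.indicator_of_mem hω, one_mul]
          exact (Set.indicator_of_mem (s := X ⁻¹' C) hω fun ω => ∫⁻ y, f (X ω) y ∂(Pr.map Y)).symm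
        · rw [Set.indicator_of_notMem hω, zero_mul]
          exact (Set.indicator_of_notMem (s := X ⁻¹' C) hω
            fun ω => ∫⁻ y, f (X ω) y ∂(Pr.map Y)).symm

end Independence

/-! ### Each batch is fresh: its law, and its independence of the past. -/

section Iterates

variable {d N b μ : ℕ} {P : Measure (Vec d)}
  {Ω : Type*} [MeasurableSpace Ω] {Pr : Measure Ω}
  {v₀ : Ω → Vec d} {x : ℕ → Ω → Vec d} {sel : ℕ → Fin N → Fin b → ℕ}

/-- The mini-batch of a round, indexed by pairs of a processor and a position. -/
def roundBatch (x : ℕ → Ω → Vec d) (sel : ℕ → Fin N → Fin b → ℕ) (t : ℕ) (ω : Ω) :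
    Fin N × Fin b → Vec d :=
  fun p => x (sel t p.1 p.2) ω

/-- The estimates up to a given round. -/
noncomputable def estimates (γ : ℕ → ℝ) (v₀ : Ω → Vec d) (x : ℕ → Ω → Vec d) (sel : ℕ → Fin N → Fin b → ℕ)
    (t : ℕ) (ω : Ω) : Fin (t + 1) → Vec d :=
  fun l => dmk γ (v₀ ω) (batches x sel ω) l

theorem measurable_roundBatch (hin : IsRandomInput P Pr v₀ x) (t : ℕ) :
    Measurable (roundBatch x sel t) :=
  measurable_pi_iff.2 fun _ => hin.measurable_sample _

theorem measurable_estimate (hin : IsRandomInput P Pr v₀ x) (γ : ℕ → ℝ) (t : ℕ) :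
    Measurable fun ω => dmk γ (v₀ ω) (batches x sel ω) t :=
  (measurable_dmk γ t).comp (hin.measurable_init.prodMk
    (measurable_pi_iff.2 fun _ => measurable_pi_iff.2 fun _ => measurable_pi_iff.2 fun _ =>
      hin.measurable_sample _))

theorem measurable_estimates (hin : IsRandomInput P Pr v₀ x) (γ : ℕ → ℝ) (t : ℕ) :
    Measurable (estimates γ v₀ x sel t) :=
  measurable_pi_iff.2 fun _ => measurable_estimate hin γ _

theorem map_roundBatch [IsProbabilityMeasure Pr] (hin : IsRandomInput P Pr v₀ x) (hsel : IsSplitter N b μ sel) (t : ℕ) :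
    Pr.map (roundBatch x sel t) = Measure.pi fun _ => P := by
  have h : iIndepFun (fun p : Fin N × Fin b => x (sel t p.1 p.2)) Pr :=
    hin.indep_samples.precomp (hsel.injective t)
  have h' := (iIndepFun_iff_map_fun_eq_pi_map fun p : Fin N × Fin b =>
    (hin.measurable_sample (sel t p.1 p.2)).aemeasurable).1 h
  simp only [hin.law_sample] at h'
  exact h'

theorem indepFun_estimates_roundBatch [IsProbabilityMeasure Pr] (hin : IsRandomInput P Pr v₀ x)
    (hsel : IsSplitter N b μ sel) (γ : ℕ → ℝ) (t : ℕ) :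
    IndepFun (estimates γ v₀ x sel t) (roundBatch x sel t) Pr := by
  classical
  let S : Finset ℕ := Finset.range (t * (N * b + μ))
  let T : Finset ℕ := Finset.Ico (t * (N * b + μ)) ((t + 1) * (N * b + μ))
  have hST : Disjoint S T := by
    rw [Finset.disjoint_left]
    intro n hn hn'
    simp only [S, T, Finset.mem_range, Finset.mem_Ico] at hn hn'
    omega
  have h1 := hin.indep_samples.indepFun_finset S T hST hin.measurable_sample
  have hmS : Measurable fun ω (n : S) => x n ω := measurable_pi_iff.2 fun _ => hin.measurable_sample _
  have hmT : Measurable fun ω (n : T) => x n ω := measurable_pi_iff.2 fun _ => hin.measurable_sample _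
  have h2 : IndepFun v₀ (fun ω => ((fun n : S => x n ω), fun n : T => x n ω)) Pr :=
    hin.indep_init.comp (φ := id) (ψ := fun y : ℕ → Vec d =>
      ((fun n : S => y n), fun n : T => y n)) measurable_id (by fun_prop)
  have h3 := IndepFun.prodMk_assoc hin.measurable_init hmS hmT h2 h1
  -- The past estimates become a function of `v₀` and the samples of earlier rounds. The filler `0`
  -- is harmless, since iterates up to `t` never read later batches (`dmk_congr`).
  let ext : (S → Vec d) → ℕ → Fin N → Fin b → Vec d := fun s u i j =>
    if h : sel u i j ∈ S then s ⟨_, h⟩ else 0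
  have hext : Measurable ext := by
    refine measurable_pi_iff.2 fun u => measurable_pi_iff.2 fun i => measurable_pi_iff.2 fun j => ?_
    by_cases h : sel u i j ∈ S
    · simp only [ext, dif_pos h]; exact measurable_pi_apply _
    · simp only [ext, dif_neg h]; exact measurable_const
  have hT : ∀ p : Fin N × Fin b, sel t p.1 p.2 ∈ T := fun p =>
    Finset.mem_Ico.2 ⟨hsel.lower t _ _, hsel.upper t _ _⟩
  have h4 := h3.comp
    (φ := fun p : Vec d × (S → Vec d) => fun l : Fin (t + 1) => dmk γ p.1 (ext p.2) l)
    (ψ := fun s : T → Vec d => fun p : Fin N × Fin b => s ⟨_, hT p⟩)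
    (measurable_pi_iff.2 fun l => (measurable_dmk γ l).comp
      (measurable_fst.prodMk (hext.comp measurable_snd)))
    (measurable_pi_iff.2 fun p => measurable_pi_apply _)
  refine h4.congr (.of_forall fun ω => ?_) .rfl
  funext l
  symm
  refine dmk_congr γ _ fun s hs => ?_
  funext i j
  have hmem : sel s i j ∈ S := by
    refine Finset.mem_range.2 ((hsel.upper s i j).trans_le ?_)
    exact Nat.mul_le_mul_right _ (by omega)
  simp only [ext, dif_pos hmem, batches]

end Iterates

/-! ### Adaptedness of the nested events. -/

section Filtration

variable {d N b : ℕ} {Ω : Type*} {v₀ : Ω → Vec d} {x : ℕ → Ω → Vec d}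
  {sel : ℕ → Fin N → Fin b → ℕ}

/-- The σ-algebra records only the sample covariances, not the samples; this suffices because
`dmk_succ` reads a batch through `batchCov` alone. -/
theorem measurable_sigmaAlg_dmk (γ : ℕ → ℝ) {l t : ℕ} (hlt : l ≤ t) :
    Measurable[sigmaAlg v₀ x sel t] fun ω => dmk γ (v₀ ω) (batches x sel ω) l := by
  induction l with
  | zero =>
    have h : Measurable[MeasurableSpace.comap v₀ inferInstance] v₀ := comap_measurable v₀
    exact h.mono le_sup_left le_rfl
  | succ l ih =>
    have hA : Measurable[sigmaAlg v₀ x sel t]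
        (fun ω (i j : Fin d) => batchCov (batches x sel ω l) i j) := by
      refine measurable_iff_comap_le.2 (le_trans ?_ le_sup_right)
      exact le_iSup (fun s : Fin t => MeasurableSpace.comap
        (fun ω (i j : Fin d) => batchCov (batches x sel ω s) i j) MeasurableSpace.pi)
        ⟨l, Nat.lt_of_succ_le hlt⟩
    simp only [dmk_succ]
    exact (measurable_krasulinaStep (γ (l + 1))).comp (hA.prodMk (ih (Nat.le_of_succ_le hlt)))

theorem measurableSet_sigmaAlg_nestedSpace (q : Vec d) (γ : ℕ → ℝ) {J : ℕ} (τ : Fin (J + 1) → ℕ)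
    (ε : Fin (J + 1) → ℝ) (t : ℕ) :
    MeasurableSet[sigmaAlg v₀ x sel t] (nestedSpace (Psi q γ v₀ x sel) τ ε (t + 1)) := by
  have h : nestedSpace (Psi q γ v₀ x sel) τ ε (t + 1) =
      ⋂ j, ⋂ l, ⋂ (_ : τ j ≤ l), ⋂ (_ : l < t + 1), {ω | Psi q γ v₀ x sel l ω ≤ 1 - ε j} := by
    ext ω; simp [nestedSpace]
  rw [h]
  refine MeasurableSet.iInter fun j => MeasurableSet.iInter fun l => MeasurableSet.iInter fun _ =>
    MeasurableSet.iInter fun hl => ?_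
  have hm : Measurable[sigmaAlg v₀ x sel t] (Psi q γ v₀ x sel l) :=
    (measurable_potential q).comp (measurable_sigmaAlg_dmk γ (Nat.lt_succ_iff.1 hl))
  exact hm measurableSet_Iic

end Filtration

/-! ### The one-level good event and the initial draw. -/

section GoodEvent

variable {d N b : ℕ} {Ω : Type*} {v₀ : Ω → Vec d} {x : ℕ → Ω → Vec d}
  {sel : ℕ → Fin N → Fin b → ℕ} {q : Vec d} {γ : ℕ → ℝ}

/-- The event that the potential stays at most `1 - ε` before time `t`. -/
def goodEvent (Ψ : ℕ → Ω → ℝ) (ε : ℝ) (t : ℕ) : Set Ω := {ω | ∀ l < t, Ψ l ω ≤ 1 - ε}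

theorem goodEvent_succ_subset (Ψ : ℕ → Ω → ℝ) (ε : ℝ) (t : ℕ) :
    goodEvent Ψ ε (t + 1) ⊆ goodEvent Ψ ε t :=
  fun _ h l hl => h l (hl.trans (Nat.lt_succ_self t))

theorem goodEvent_eq_preimage (ε : ℝ) (t : ℕ) :
    goodEvent (Psi q γ v₀ x sel) ε (t + 1) =
      estimates γ v₀ x sel t ⁻¹' {p | ∀ l, potential q (p l) ≤ 1 - ε} := by
  ext ω
  constructor
  · exact fun h l => h l l.2
  · exact fun h l hl => h ⟨l, hl⟩

theorem measurableSet_goodEvent [MeasurableSpace Ω] {Ψ : ℕ → Ω → ℝ} (h : ∀ t, Measurable (Ψ t)) (ε : ℝ) (t : ℕ) :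
    MeasurableSet (goodEvent Ψ ε t) := by
  have : goodEvent Ψ ε t = ⋂ l, ⋂ (_ : l < t), {ω | Ψ l ω ≤ 1 - ε} := by
    ext ω; simp [goodEvent]
  rw [this]
  exact MeasurableSet.iInter fun l => MeasurableSet.iInter fun _ => h l measurableSet_Iic

theorem measurableSet_potential_le (ε : ℝ) (t : ℕ) :
    MeasurableSet {p : Fin (t + 1) → Vec d | ∀ l, potential q (p l) ≤ 1 - ε} := by
  have : {p : Fin (t + 1) → Vec d | ∀ l, potential q (p l) ≤ 1 - ε} =
      ⋂ l, {p | potential q (p l) ≤ 1 - ε} := by ext p; simp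
  rw [this]
  exact MeasurableSet.iInter fun l =>
    ((measurable_potential q).comp (measurable_pi_apply l)) measurableSet_Iic

theorem measurable_Psi [MeasurableSpace Ω] {P : Measure (Vec d)} {Pr : Measure Ω}
    (hin : IsRandomInput P Pr v₀ x) (t : ℕ) :
    Measurable (Psi q γ v₀ x sel t) :=
  (measurable_potential q).comp (measurable_estimate hin γ t)

/-- The probability that a uniformly random start is almost orthogonal to `q`. -/
theorem measure_init_le [MeasurableSpace Ω] {P : Measure (Vec d)} {Pr : Measure Ω}
    (hd : 2 ≤ d) (hq : ‖q‖ = 1) (hin : IsRandomInput P Pr v₀ x) {η : ℝ}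
    (hη : 0 < η) :
    Pr {ω | Psi q γ v₀ x sel 0 ω ≤ 1 - η}ᶜ ≤ ENNReal.ofReal (√(Real.exp 1 * d * η)) := by
  refine le_trans ?_ (sphereUniform_cone_le hd hq hη)
  rw [← hin.law_init, Measure.map_apply hin.measurable_init
    (measurableSet_le (by fun_prop) (by fun_prop))]
  refine measure_mono fun ω hω => ?_
  have h : 1 - η < potential q (v₀ ω) := not_le.1 hω
  have h1 : (inner ℝ (v₀ ω) q : ℝ) ^ 2 / ‖v₀ ω‖ ^ 2 < η := by unfold potential at h; linarith
  show (inner ℝ (v₀ ω) q : ℝ) ^ 2 ≤ η * ‖v₀ ω‖ ^ 2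
  -- Division by zero gives the zero vector potential `1`, but it also lies in the cone.
  by_cases h0 : ‖v₀ ω‖ = 0
  · rw [norm_eq_zero.1 h0]; simp
  · exact ((div_lt_iff₀ (by positivity)).1 h1).le

end GoodEvent

/-! ### The recursion for `E[tan²]` and the maximal inequality. -/

section Recursion

variable {d N b μ : ℕ} {P : Measure (Vec d)} [IsProbabilityMeasure P] {r : ℝ}
  {Ω : Type*} [MeasurableSpace Ω] {Pr : Measure Ω} [IsProbabilityMeasure Pr]
  {v₀ : Ω → Vec d} {x : ℕ → Ω → Vec d} {sel : ℕ → Fin N → Fin b → ℕ} {q : Vec d} {γ : ℕ → ℝ}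

/-- The one-step bound is integrated over frozen histories. The set `C` is left general: it is the
good event for the decay estimate, and the good event cut down by the initial condition for the
maximal inequality. -/
theorem lintegral_tanSq_succ_le (hd : 2 ≤ d) (hN : 0 < N) (hb : 0 < b)
    (hbound : ∀ᵐ x ∂P, ‖x‖ ≤ r) (hgap : secondEig hd P < topEig hd P)
    (hq : ‖q‖ = 1) (hqeig : matOp (covMat P) q = topEig hd P • q)
    (hin : IsRandomInput P Pr v₀ x) (hsel : IsSplitter N b μ sel) {ε : ℝ} (hε : 0 < ε) (t : ℕ)
    (hγ : 0 ≤ γ (t + 1)) (hsmall : (10 * γ (t + 1) * r ^ 2) ^ 2 ≤ ε)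
    (hgγ : 2 * γ (t + 1) * (topEig hd P - secondEig hd P) ≤ 1)
    {C : Set (Fin (t + 1) → Vec d)} (hC : MeasurableSet C)
    (hCε : ∀ p ∈ C, potential q (p (Fin.last t)) ≤ 1 - ε) :
    ∫⁻ ω in estimates γ v₀ x sel t ⁻¹' C, tanSq q (dmk γ (v₀ ω) (batches x sel ω) (t + 1)) ∂Pr ≤
      ENNReal.ofReal (1 - 2 * γ (t + 1) * (topEig hd P - secondEig hd P) +
          γ (t + 1) ^ 2 * (6 * topEig hd P ^ 2 + 6 * batchVar P N b / ε)) *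
        ∫⁻ ω in estimates γ v₀ x sel t ⁻¹' C, tanSq q (dmk γ (v₀ ω) (batches x sel ω) t) ∂Pr +
      ENNReal.ofReal (2 * γ (t + 1) ^ 2 * batchVar P N b) *
        Pr (estimates γ v₀ x sel t ⁻¹' C) := by
  have hE := measurable_estimates (sel := sel) hin γ t
  have hV := batchVar_nonneg P N b
  let f : (Fin (t + 1) → Vec d) → (Fin N × Fin b → Vec d) → ENNReal := fun p y =>
    tanSq q (krasulinaStep (γ (t + 1)) (matOp (batchCov fun i j => y (i, j))) (p (Fin.last t)))
  have hy : Measurable fun p : (Fin (t + 1) → Vec d) × (Fin N × Fin b → Vec d) =>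
      fun i j => p.2 (i, j) := by fun_prop
  have hp : Measurable fun p : (Fin (t + 1) → Vec d) × (Fin N × Fin b → Vec d) =>
      p.1 (Fin.last t) := by fun_prop
  have hf : Measurable (Function.uncurry f) := (measurable_tanSq q).comp
    ((measurable_krasulinaStep (γ (t + 1))).comp ((measurable_batchCov.comp hy).prodMk hp))
  have h1 : ∫⁻ ω in estimates γ v₀ x sel t ⁻¹' C,
      tanSq q (dmk γ (v₀ ω) (batches x sel ω) (t + 1)) ∂Pr =
      ∫⁻ ω in estimates γ v₀ x sel t ⁻¹' C,
        f (estimates γ v₀ x sel t ω) (roundBatch x sel t ω) ∂Pr := by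
    refine lintegral_congr fun ω => ?_
    rw [dmk_succ]
    rfl
  rw [h1, IndepFun.lintegral_eq hE (measurable_roundBatch hin t)
    (indepFun_estimates_roundBatch hin hsel γ t) hf hC, map_roundBatch hin hsel]
  set ρ : ℝ := 1 - 2 * γ (t + 1) * (topEig hd P - secondEig hd P) +
          γ (t + 1) ^ 2 * (6 * topEig hd P ^ 2 + 6 * batchVar P N b / ε) with hρdef
  have hρ : 0 ≤ ρ := by
    have : 0 ≤ γ (t + 1) ^ 2 * (6 * topEig hd P ^ 2 + 6 * batchVar P N b / ε) := by positivity
    linarith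
  have htan : Measurable fun ω => tanSq q (dmk γ (v₀ ω) (batches x sel ω) t) :=
    (measurable_tanSq q).comp (measurable_estimate hin γ t)
  calc _ ≤ ∫⁻ ω in estimates γ v₀ x sel t ⁻¹' C,
        (ENNReal.ofReal ρ * tanSq q (dmk γ (v₀ ω) (batches x sel ω) t) +
          ENNReal.ofReal (2 * γ (t + 1) ^ 2 * batchVar P N b)) ∂Pr := by
        refine setLIntegral_mono' (hE hC) fun ω hω => ?_
        obtain ⟨h2, h3⟩ := of_potential_le hε (hCε _ hω)
        obtain ⟨h4, h5⟩ := lintegral_secSq_step_le hd hN hb hbound hgap hq hqeig hγ hε hsmall h2 h3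
        have h6 := one_le_secSq hq h2
        have h7 : tanSq q (dmk γ (v₀ ω) (batches x sel ω) t) =
            ENNReal.ofReal (secSq q (estimates γ v₀ x sel t ω (Fin.last t)) - 1) := tanSq_of_ne h2
        rw [h7, ← ENNReal.ofReal_mul hρ, ← ENNReal.ofReal_add
          (mul_nonneg hρ (by linarith)) (by positivity), mul_comm ρ]
        refine le_trans (lintegral_mono_ae ?_) h4
        filter_upwards [h5] with y hy
        -- A new iterate orthogonal to `q` would have `secSq = 0` by division by zero, against `1 ≤
        -- secSq`; so `⊤` is almost surely not taken.
        refine (tanSq_of_ne fun h0 => ?_).le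
        rw [secSq, h0] at hy
        norm_num at hy
    _ = _ := by
        rw [lintegral_add_right _ measurable_const, lintegral_const_mul _ htan, setLIntegral_const]

/-- A bound on `E[tan² ; good event]` by any solution of the one-step recursion. -/
theorem setLIntegral_tanSq_le (hd : 2 ≤ d) (hN : 0 < N) (hb : 0 < b)
    (hbound : ∀ᵐ x ∂P, ‖x‖ ≤ r) (hgap : secondEig hd P < topEig hd P)
    (hq : ‖q‖ = 1) (hqeig : matOp (covMat P) q = topEig hd P • q)
    (hin : IsRandomInput P Pr v₀ x) (hsel : IsSplitter N b μ sel) {ε : ℝ} (hε : 0 < ε)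
    (hγ : ∀ t, 0 ≤ γ (t + 1)) (hsmall : ∀ t, (10 * γ (t + 1) * r ^ 2) ^ 2 ≤ ε)
    (hgγ : ∀ t, 2 * γ (t + 1) * (topEig hd P - secondEig hd P) ≤ 1)
    {u : ℕ → ℝ} (hu0 : 1 / ε ≤ u 0) (hupos : ∀ t, 0 ≤ u t)
    (hu : ∀ t, (1 - 2 * γ (t + 1) * (topEig hd P - secondEig hd P) +
          γ (t + 1) ^ 2 * (6 * topEig hd P ^ 2 + 6 * batchVar P N b / ε)) * u t +
        2 * γ (t + 1) ^ 2 * batchVar P N b ≤ u (t + 1)) (t : ℕ) :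
    ∫⁻ ω in goodEvent (Psi q γ v₀ x sel) ε (t + 1),
        tanSq q (dmk γ (v₀ ω) (batches x sel ω) t) ∂Pr ≤ ENNReal.ofReal (u t) ∧
    ∫⁻ ω in goodEvent (Psi q γ v₀ x sel) ε (t + 1),
      tanSq q (dmk γ (v₀ ω) (batches x sel ω) (t + 1)) ∂Pr ≤ ENNReal.ofReal (u (t + 1)) := by
  have hV := batchVar_nonneg P N b
  have step : ∀ t, ∫⁻ ω in goodEvent (Psi q γ v₀ x sel) ε (t + 1),
        tanSq q (dmk γ (v₀ ω) (batches x sel ω) t) ∂Pr ≤ ENNReal.ofReal (u t) →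
      ∫⁻ ω in goodEvent (Psi q γ v₀ x sel) ε (t + 1),
        tanSq q (dmk γ (v₀ ω) (batches x sel ω) (t + 1)) ∂Pr ≤ ENNReal.ofReal (u (t + 1)) := by
    intro t h
    have h1 := lintegral_tanSq_succ_le hd hN hb hbound hgap hq hqeig hin hsel hε t (hγ t)
      (hsmall t) (hgγ t) (measurableSet_potential_le (q := q) ε t) (fun p hp => hp _)
    rw [← goodEvent_eq_preimage] at h1
    have hρ : 0 ≤ 1 - 2 * γ (t + 1) * (topEig hd P - secondEig hd P) +
          γ (t + 1) ^ 2 * (6 * topEig hd P ^ 2 + 6 * batchVar P N b / ε) := by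
      have h2 := hgγ t
      have : 0 ≤ γ (t + 1) ^ 2 * (6 * topEig hd P ^ 2 + 6 * batchVar P N b / ε) := by positivity
      linarith
    refine h1.trans ?_
    calc _ ≤ ENNReal.ofReal (1 - 2 * γ (t + 1) * (topEig hd P - secondEig hd P) +
          γ (t + 1) ^ 2 * (6 * topEig hd P ^ 2 + 6 * batchVar P N b / ε)) * ENNReal.ofReal (u t) +
          ENNReal.ofReal (2 * γ (t + 1) ^ 2 * batchVar P N b) * 1 := by
          gcongr
          exact prob_le_one
      _ ≤ _ := by
          rw [mul_one, ← ENNReal.ofReal_mul hρ, ← ENNReal.ofReal_add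
            (mul_nonneg hρ (hupos t)) (by positivity)]
          exact ENNReal.ofReal_le_ofReal (hu t)
  have main : ∀ t, ∫⁻ ω in goodEvent (Psi q γ v₀ x sel) ε (t + 1),
        tanSq q (dmk γ (v₀ ω) (batches x sel ω) t) ∂Pr ≤ ENNReal.ofReal (u t) := by
    intro t
    induction t with
    | zero =>
      calc _ ≤ ∫⁻ _ω in goodEvent (Psi q γ v₀ x sel) ε (0 + 1), ENNReal.ofReal (1 / ε) ∂Pr := by
            refine setLIntegral_mono' (measurableSet_goodEvent (measurable_Psi hin) _ _)
              fun ω hω => le_trans le_add_self (one_add_tanSq_le hq hε (hω 0 zero_lt_one))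
        _ ≤ ENNReal.ofReal (1 / ε) * 1 := by
            rw [setLIntegral_const]; gcongr; exact prob_le_one
        _ ≤ _ := by rw [mul_one]; exact ENNReal.ofReal_le_ofReal hu0
    | succ t ih =>
      -- The good event shrinks with time and `tan² ≥ 0`, so restricting after each step only lowers
      -- the integral.
      exact (lintegral_mono_set (goodEvent_succ_subset _ _ _)).trans (step t ih)
  exact ⟨main t, step t (main t)⟩

/-- The maximal inequality: starting from a potential of at most `1 - η`, the potential is unlikely
ever to exceed `1 - ε`. -/
theorem measure_diff_goodEvent_le (hd : 2 ≤ d) (hN : 0 < N) (hb : 0 < b)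
    (hbound : ∀ᵐ x ∂P, ‖x‖ ≤ r) (hgap : secondEig hd P < topEig hd P)
    (hq : ‖q‖ = 1) (hqeig : matOp (covMat P) q = topEig hd P • q)
    (hin : IsRandomInput P Pr v₀ x) (hsel : IsSplitter N b μ sel) {ε η : ℝ} (hε : 0 < ε)
    (hεη : ε ≤ η)
    (hγ : ∀ t, 0 ≤ γ (t + 1)) (hsmall : ∀ t, (10 * γ (t + 1) * r ^ 2) ^ 2 ≤ ε)
    (hgγ : ∀ t, 2 * γ (t + 1) * (topEig hd P - secondEig hd P) ≤ 1)
    {w : ℕ → ℝ} (hw0 : 1 / η ≤ w 0)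
    (hw : ∀ t, (1 + γ (t + 1) ^ 2 * (6 * topEig hd P ^ 2 + 6 * batchVar P N b / ε) +
      2 * γ (t + 1) ^ 2 * batchVar P N b) * w t ≤ w (t + 1)) (t : ℕ) :
    Pr ({ω | Psi q γ v₀ x sel 0 ω ≤ 1 - η} \ goodEvent (Psi q γ v₀ x sel) ε (t + 1)) ≤
      ENNReal.ofReal (ε * w t) := by
  have hV := batchVar_nonneg P N b
  have hη : 0 < η := hε.trans_le hεη
  set G : Set Ω := {ω | Psi q γ v₀ x sel 0 ω ≤ 1 - η} with hG
  set E : ℕ → Set Ω := goodEvent (Psi q γ v₀ x sel) ε with hEdef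
  have hGm : MeasurableSet G := measurable_Psi hin 0 measurableSet_Iic
  have hEm : ∀ t, MeasurableSet (E t) := measurableSet_goodEvent (measurable_Psi hin) _
  let Y : ℕ → Ω → ENNReal := fun t ω => tanSq q (dmk γ (v₀ ω) (batches x sel ω) t)
  have hYm : ∀ t, Measurable (Y t) := fun t =>
    (measurable_tanSq q).comp (measurable_estimate hin γ t)
  -- Invariant of the stopped process: paths still inside carry `1 + tan²`, paths that have left
  -- carry the exit value `1/ε`.
  have key : ∀ t, ∫⁻ ω in G ∩ E (t + 1), (1 + Y t ω) ∂Pr +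
      ENNReal.ofReal (1 / ε) * Pr (G \ E (t + 1)) ≤ ENNReal.ofReal (w t) := by
    intro t
    induction t with
    | zero =>
      have h0 : G \ E (0 + 1) = ∅ := by
        rw [Set.sdiff_eq_empty]
        intro ω hω l hl
        obtain rfl : l = 0 := by omega
        have : Psi q γ v₀ x sel 0 ω ≤ 1 - η := hω
        linarith
      rw [h0, measure_empty, mul_zero, add_zero]
      calc _ ≤ ∫⁻ _ω in G ∩ E (0 + 1), ENNReal.ofReal (1 / η) ∂Pr :=
            setLIntegral_mono' (hGm.inter (hEm _)) fun ω hω => one_add_tanSq_le hq hη hω.1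
        _ ≤ ENNReal.ofReal (1 / η) * 1 := by
            rw [setLIntegral_const]; gcongr; exact prob_le_one
        _ ≤ _ := by rw [mul_one]; exact ENNReal.ofReal_le_ofReal hw0
    | succ t ih =>
      set A : Set Ω := G ∩ E (t + 1) with hA
      have hAm : MeasurableSet A := hGm.inter (hEm _)
      have hsub : E (t + 2) ⊆ E (t + 1) := goodEvent_succ_subset _ _ _
      have hA2 : G ∩ E (t + 2) = A ∩ E (t + 2) := by
        rw [hA, Set.inter_assoc, Set.inter_eq_right.2 hsub]
      have hstep : ∫⁻ ω in A, (1 + Y (t + 1) ω) ∂Pr ≤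
          ENNReal.ofReal (1 + γ (t + 1) ^ 2 * (6 * topEig hd P ^ 2 + 6 * batchVar P N b / ε) +
            2 * γ (t + 1) ^ 2 * batchVar P N b) * ∫⁻ ω in A, (1 + Y t ω) ∂Pr := by
        set k : ℝ := γ (t + 1) ^ 2 * (6 * topEig hd P ^ 2 + 6 * batchVar P N b / ε) with hk
        set s : ℝ := 2 * γ (t + 1) ^ 2 * batchVar P N b with hs
        have hk0 : 0 ≤ k := by positivity
        have hs0 : 0 ≤ s := by positivity
        have hC : MeasurableSet ({p : Fin (t + 1) → Vec d | potential q (p 0) ≤ 1 - η} ∩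
            {p | ∀ l, potential q (p l) ≤ 1 - ε}) :=
          (((measurable_potential q).comp (measurable_pi_apply 0)) measurableSet_Iic).inter
            (measurableSet_potential_le ε t)
        have h1 := lintegral_tanSq_succ_le hd hN hb hbound hgap hq hqeig hin hsel hε t (hγ t)
          (hsmall t) (hgγ t) hC (fun p hp => hp.2 _)
        have hpre : estimates γ v₀ x sel t ⁻¹'
            ({p : Fin (t + 1) → Vec d | potential q (p 0) ≤ 1 - η} ∩
              {p | ∀ l, potential q (p l) ≤ 1 - ε}) = A := by
          rw [Set.preimage_inter, ← goodEvent_eq_preimage]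
          rfl
        rw [hpre] at h1
        rw [lintegral_add_left measurable_const, lintegral_add_left measurable_const,
          setLIntegral_const, one_mul]
        -- The contraction is not needed here and is dropped; the additive noise is absorbed by the
        -- `1` in `1 + tan²`.
        have hρ : ENNReal.ofReal (1 - 2 * γ (t + 1) * (topEig hd P - secondEig hd P) + k) ≤
            ENNReal.ofReal (1 + k + s) := ENNReal.ofReal_le_ofReal (by
          have := mul_nonneg (hγ t) (by linarith : 0 ≤ topEig hd P - secondEig hd P)
          linarith)
        calc Pr A + ∫⁻ ω in A, Y (t + 1) ω ∂Pr
            ≤ Pr A + (ENNReal.ofReal (1 + k + s) * ∫⁻ ω in A, Y t ω ∂Pr +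
                ENNReal.ofReal s * Pr A) := by
              gcongr
              exact h1.trans (by gcongr)
          _ = (1 + ENNReal.ofReal s) * Pr A +
                ENNReal.ofReal (1 + k + s) * ∫⁻ ω in A, Y t ω ∂Pr := by ring
          _ ≤ ENNReal.ofReal (1 + k + s) * Pr A +
                ENNReal.ofReal (1 + k + s) * ∫⁻ ω in A, Y t ω ∂Pr := by
              gcongr
              rw [← ENNReal.ofReal_one, ← ENNReal.ofReal_add zero_le_one hs0]
              exact ENNReal.ofReal_le_ofReal (by linarith)
          _ = _ := by ring
      -- Paths that leave just now satisfy `1 + tan² ≥ 1/ε`, so stopping them at the value `1/ε`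
      -- does not increase the total.
      have hsplit : ∫⁻ ω in G ∩ E (t + 2), (1 + Y (t + 1) ω) ∂Pr +
          ENNReal.ofReal (1 / ε) * Pr (A \ E (t + 2)) ≤ ∫⁻ ω in A, (1 + Y (t + 1) ω) ∂Pr := by
        rw [hA2, ← lintegral_inter_add_sdiff _ A (hEm (t + 2))]
        gcongr
        rw [← setLIntegral_const]
        refine setLIntegral_mono' (hAm.diff (hEm _)) fun ω hω => le_one_add_tanSq hq hε ?_
        by_contra hcon
        refine hω.2 fun l hl => ?_
        rcases Nat.lt_succ_iff_lt_or_eq.1 hl with h | rfl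
        · exact hω.1.2 l h
        · exact not_lt.1 hcon
      have hQ : Pr (G \ E (t + 2)) ≤ Pr (A \ E (t + 2)) + Pr (G \ E (t + 1)) := by
        refine (measure_mono fun ω hω => ?_).trans (measure_union_le _ _)
        by_cases h : ω ∈ E (t + 1)
        · exact Or.inl ⟨⟨hω.1, h⟩, hω.2⟩
        · exact Or.inr ⟨hω.1, h⟩
      set θ : ℝ := 1 + γ (t + 1) ^ 2 * (6 * topEig hd P ^ 2 + 6 * batchVar P N b / ε) +
            2 * γ (t + 1) ^ 2 * batchVar P N b with hθ
      have hθ1 : 1 ≤ θ := by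
        have h1 : 0 ≤ γ (t + 1) ^ 2 * (6 * topEig hd P ^ 2 + 6 * batchVar P N b / ε) := by positivity
        have h2 : 0 ≤ 2 * γ (t + 1) ^ 2 * batchVar P N b := by positivity
        linarith
      calc ∫⁻ ω in G ∩ E (t + 2), (1 + Y (t + 1) ω) ∂Pr +
            ENNReal.ofReal (1 / ε) * Pr (G \ E (t + 2))
          ≤ ∫⁻ ω in G ∩ E (t + 2), (1 + Y (t + 1) ω) ∂Pr +
            ENNReal.ofReal (1 / ε) * (Pr (A \ E (t + 2)) + Pr (G \ E (t + 1))) := by gcongr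
        _ = (∫⁻ ω in G ∩ E (t + 2), (1 + Y (t + 1) ω) ∂Pr +
            ENNReal.ofReal (1 / ε) * Pr (A \ E (t + 2))) +
            1 * (ENNReal.ofReal (1 / ε) * Pr (G \ E (t + 1))) := by ring
        _ ≤ ENNReal.ofReal θ * ∫⁻ ω in A, (1 + Y t ω) ∂Pr +
            ENNReal.ofReal θ * (ENNReal.ofReal (1 / ε) * Pr (G \ E (t + 1))) := by
            gcongr
            · exact hsplit.trans hstep
            · rw [← ENNReal.ofReal_one]; exact ENNReal.ofReal_le_ofReal hθ1
        _ = ENNReal.ofReal θ * (∫⁻ ω in A, (1 + Y t ω) ∂Pr +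
            ENNReal.ofReal (1 / ε) * Pr (G \ E (t + 1))) := by ring
        _ ≤ ENNReal.ofReal θ * ENNReal.ofReal (w t) := by gcongr
        _ ≤ _ := by
            rw [← ENNReal.ofReal_mul (by linarith)]
            exact ENNReal.ofReal_le_ofReal (hw t)
  have h1 : ENNReal.ofReal (1 / ε) * Pr (G \ E (t + 1)) ≤ ENNReal.ofReal (w t) :=
    le_trans le_add_self (key t)
  calc Pr (G \ E (t + 1)) = ENNReal.ofReal ε * (ENNReal.ofReal (1 / ε) * Pr (G \ E (t + 1))) := by
        rw [← mul_assoc, ← ENNReal.ofReal_mul hε.le, mul_one_div_cancel hε.ne', ENNReal.ofReal_one,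
          one_mul]
    _ ≤ ENNReal.ofReal ε * ENNReal.ofReal (w t) := by gcongr
    _ = _ := (ENNReal.ofReal_mul hε.le).symm

end Recursion

/-! ### Numerical constraints and the explicit supersolution. -/

section Constants

/-- Here `L₁` pays for `c²λ₁²` and for the smallness of the steps, while `V L₂` pays for the
amplified noise `c²V/ε`. The value `0.3` limits the exponent of the weights. -/
theorem step_constants {D r δ c₀ c g l₁ V L₁ L₂ : ℝ} (hD : 2 ≤ D) (hr : 1 ≤ r) (hδ₀ : 0 < δ)
    (hδ₁ : δ < 1) (hc₀ : 2 < c₀) (hg : 0 < g) (hgl : g ≤ l₁) (hl : l₁ ≤ r ^ 2)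
    (hc : c = c₀ / (2 * g))
    (hL₁ : 64 * Real.exp 1 * D * r ^ 4 * max 1 (c ^ 2) / δ ^ 2 * Real.log (4 / δ) ≤ L₁)
    (hL₂ : 512 * Real.exp 1 ^ 2 * D ^ 2 * max 1 (c ^ 2) / δ ^ 4 * Real.log (4 / δ) ≤ L₂)
    (hV : 0 ≤ V) :
    0 < c ∧ 0 < L₂ ∧ 100 * c₀ ≤ L₁ ∧
    (10 * (c / (L₁ + V * L₂)) * r ^ 2) ^ 2 ≤ δ ^ 3 / (128 * Real.exp 1 * D) ∧
    (6 * l₁ ^ 2 + 8 * V / (δ ^ 3 / (128 * Real.exp 1 * D))) * c ^ 2 / (L₁ + V * L₂) ≤ 0.3 := by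
  have hcpos : 0 < c := by rw [hc]; positivity
  have hcg : c * g = c₀ / 2 := by rw [hc]; field_simp
  have hlog : 1.38 ≤ Real.log (4 / δ) := by
    have h1 : Real.log 4 ≤ Real.log (4 / δ) := by
      apply Real.log_le_log (by norm_num)
      rw [le_div_iff₀ hδ₀]; linarith
    have h2 : Real.log 4 = 2 * Real.log 2 := by
      rw [show (4 : ℝ) = 2 ^ 2 by norm_num, Real.log_pow]; norm_num
    have := Real.log_two_gt_d9
    linarith
  set ℓ := Real.log (4 / δ)
  obtain ⟨Q, hQdef⟩ : ∃ Q, Q = Real.exp 1 * D := ⟨_, rfl⟩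
  have hQ : 5.4 ≤ Q := by
    have := Real.exp_one_gt_d9
    rw [hQdef]; nlinarith
  have hQl : 7.45 ≤ Q * ℓ := by nlinarith
  have hQpos : 0 < Q := by linarith
  have hM : c ^ 2 ≤ max 1 (c ^ 2) := le_max_right _ _
  have hM1 : 1 ≤ max 1 (c ^ 2) := le_max_left _ _
  set M := max 1 (c ^ 2)
  have e1 : 64 * Real.exp 1 * D * r ^ 4 * M / δ ^ 2 * ℓ = 64 * (Q * ℓ) * r ^ 4 * M / δ ^ 2 := by
    rw [hQdef]; ring
  have e2 : 512 * Real.exp 1 ^ 2 * D ^ 2 * M / δ ^ 4 * ℓ = 512 * Q * (Q * ℓ) * M / δ ^ 4 := by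
    rw [hQdef]; ring
  have e3 : 128 * Real.exp 1 * D = 128 * Q := by rw [hQdef]; ring
  rw [e1, div_le_iff₀ (by positivity)] at hL₁
  rw [e2, div_le_iff₀ (by positivity)] at hL₂
  rw [e3]
  obtain ⟨W, hW⟩ : ∃ W, W = Q * ℓ := ⟨_, rfl⟩
  rw [← hW] at hL₁ hL₂ hQl
  have hWpos : 0 < W := by linarith
  have hr4 : 0 < r ^ 4 := by positivity
  have F1 : 64 * W * (c ^ 2 * r ^ 4) ≤ L₁ * δ ^ 2 := by
    refine le_trans ?_ hL₁
    have := mul_le_mul_of_nonneg_left hM (by positivity : 0 ≤ 64 * W * r ^ 4)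
    linarith
  have F2 : 512 * Q * W * c ^ 2 ≤ L₂ * δ ^ 4 := by
    refine le_trans ?_ hL₂
    exact mul_le_mul_of_nonneg_left hM (by positivity)
  have hL₂pos : 0 < L₂ := by
    have : 0 < L₂ * δ ^ 4 := lt_of_lt_of_le (by positivity) F2
    exact pos_of_mul_pos_left this (by positivity)
  have hδ2 : δ ^ 2 ≤ 1 := by nlinarith
  have hL₁pos : 0 < L₁ := by
    have : 0 < L₁ * δ ^ 2 := lt_of_lt_of_le (by positivity) F1
    exact pos_of_mul_pos_left this (by positivity)
  have hVL : 0 ≤ V * L₂ := by positivity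
  set L := L₁ + V * L₂ with hL
  have hLpos : 0 < L := by linarith
  -- Since `g ≤ λ₁ ≤ r²`, the choice of `c` forces `c r² > 1`, so `c r²` may be replaced by `c² r⁴`,
  -- which `L₁` controls.
  have hcr : c₀ / 2 ≤ c * r ^ 2 := by
    rw [← hcg]; exact mul_le_mul_of_nonneg_left (hgl.trans hl) hcpos.le
  have hcr2 : (c₀ / 2) * (c * r ^ 2) ≤ c ^ 2 * r ^ 4 := by
    have := mul_le_mul_of_nonneg_right hcr (by positivity : 0 ≤ c * r ^ 2)
    calc _ ≤ c * r ^ 2 * (c * r ^ 2) := this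
      _ = _ := by ring
  refine ⟨hcpos, hL₂pos, ?_, ?_, ?_⟩
  · have h1 : L₁ * δ ^ 2 ≤ L₁ := mul_le_of_le_one_right hL₁pos.le hδ2
    have h2 : (c₀ / 2) * (c₀ / 2) ≤ c ^ 2 * r ^ 4 :=
      (mul_le_mul_of_nonneg_left hcr (by linarith)).trans hcr2
    have h3 : 64 * 7.45 * ((c₀ / 2) * (c₀ / 2)) ≤ 64 * W * (c ^ 2 * r ^ 4) := by gcongr
    have h4 : 2 * c₀ ≤ c₀ * c₀ := mul_le_mul_of_nonneg_right hc₀.le (by linarith)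
    linarith
  · have h1 : 10 * (c / L) * r ^ 2 ≤ 10 * δ ^ 2 / (64 * W) := by
      rw [le_div_iff₀ (by positivity)]
      have h2 : 10 * (c / L) * r ^ 2 * (64 * W) = 10 * (64 * W * (c * r ^ 2)) / L := by ring
      rw [h2, div_le_iff₀ hLpos]
      have h3 : c * r ^ 2 ≤ c ^ 2 * r ^ 4 :=
        (le_mul_of_one_le_left (by positivity) (by linarith)).trans hcr2
      have h4 : 64 * W * (c * r ^ 2) ≤ L * δ ^ 2 := by
        calc _ ≤ 64 * W * (c ^ 2 * r ^ 4) := by gcongr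
          _ ≤ L₁ * δ ^ 2 := F1
          _ ≤ L * δ ^ 2 := by gcongr; linarith
      linarith
    calc (10 * (c / L) * r ^ 2) ^ 2 ≤ (10 * δ ^ 2 / (64 * W)) ^ 2 :=
          pow_le_pow_left₀ (by positivity) h1 2
      _ ≤ _ := by
          rw [div_pow, div_le_div_iff₀ (by positivity) (by positivity)]
          have h5 : 12800 * δ * Q ≤ 4096 * W ^ 2 := by
            have h6 : 7.45 * 1.38 ≤ W * ℓ := by gcongr
            have h7 : W ^ 2 = Q * (W * ℓ) := by rw [hW]; ring
            have h8 : Q * (7.45 * 1.38) ≤ Q * (W * ℓ) := by gcongr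
            have h9 : Q * δ ≤ Q * 1 := by gcongr
            rw [h7]
            linarith
          have h6 := mul_le_mul_of_nonneg_left h5 (by positivity : 0 ≤ δ ^ 3)
          calc (10 * δ ^ 2) ^ 2 * (128 * Q) = δ ^ 3 * (12800 * δ * Q) := by ring
            _ ≤ _ := h6
            _ = _ := by ring
  · rw [div_le_iff₀ hLpos]
    have h1 : 6 * l₁ ^ 2 * c ^ 2 ≤ 0.0127 * L := by
      have h2 : l₁ ^ 2 ≤ r ^ 4 := by
        calc l₁ ^ 2 ≤ (r ^ 2) ^ 2 := pow_le_pow_left₀ (by linarith) hl 2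
          _ = r ^ 4 := by ring
      have h3 : 64 * 7.45 * (c ^ 2 * r ^ 4) ≤ L := by
        calc _ ≤ 64 * W * (c ^ 2 * r ^ 4) := by gcongr
          _ ≤ L₁ * δ ^ 2 := F1
          _ ≤ L₁ * 1 := by gcongr
          _ ≤ L := by linarith
      have h4 : l₁ ^ 2 * c ^ 2 ≤ c ^ 2 * r ^ 4 := by
        rw [mul_comm]; gcongr
      linarith
    have h2 : 8 * V / (δ ^ 3 / (128 * Q)) * c ^ 2 ≤ 0.27 * L := by
      have h3 : 8 * V / (δ ^ 3 / (128 * Q)) * c ^ 2 =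
          2 * (V * (512 * Q * W * c ^ 2)) / (δ ^ 3 * W) := by
        field_simp; ring
      rw [h3, div_le_iff₀ (by positivity)]
      have h4 : V * (512 * Q * W * c ^ 2) ≤ L * δ ^ 4 := by
        calc _ ≤ V * (L₂ * δ ^ 4) := by gcongr
          _ = V * L₂ * δ ^ 4 := by ring
          _ ≤ _ := by gcongr; linarith
      have h5 : L * δ ^ 4 ≤ L * δ ^ 3 := by
        apply mul_le_mul_of_nonneg_left _ hLpos.le
        exact pow_le_pow_of_le_one hδ₀.le hδ₁.le (by norm_num)
      have h6 : L * δ ^ 3 * 7.45 ≤ L * δ ^ 3 * W := by gcongr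
      have h7 : 0 < L * δ ^ 3 := by positivity
      linarith
    rw [add_mul]
    linarith

/-- The weight `exp (k (1/L - 1/(L+t)))` absorbs the second-order terms `k / (L+t)²`. -/
theorem one_add_mul_exp_le {k L X a : ℝ} (hk : 0 ≤ k) (hX : 1 < X) :
    Real.exp (-a + k / X ^ 2) * Real.exp (k * (1 / L - 1 / (X - 1))) ≤
      Real.exp (-a) * Real.exp (k * (1 / L - 1 / X)) := by
  rw [← Real.exp_add, ← Real.exp_add, Real.exp_le_exp]
  -- The telescoping bound that keeps the accumulated exponent below `k/L`.
  have h1 : 1 / X ^ 2 ≤ 1 / (X - 1) - 1 / X := by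
    have h0 : 0 < X - 1 := by linarith
    rw [div_sub_div _ _ h0.ne' (by linarith), div_le_div_iff₀ (by positivity) (by positivity)]
    nlinarith
  have := mul_le_mul_of_nonneg_left h1 hk
  have e : k / X ^ 2 = k * (1 / X ^ 2) := by ring
  rw [e]
  nlinarith

/-- An explicit solution of the one-step recursion for `tan²`. -/
theorem explicit_recursion {k L X c₀ a V K : ℝ} (hk : 0 ≤ k) (hL : 0 < L) (hX : L + 1 ≤ X)
    (hc₀ : 2 < c₀) (hLc : 100 * c₀ ≤ L) (ha : 0 ≤ a) (hV : 0 ≤ V)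
    (hK : K = 1.2 * V / (c₀ - 1)) :
    (1 - c₀ / X + k / X ^ 2) *
        (Real.exp (k * (1 / L - 1 / (X - 1))) * (a * ((L + 1) / X) ^ c₀ + K / X)) + V / X ^ 2 ≤
      Real.exp (k * (1 / L - 1 / X)) * (a * ((L + 1) / (X + 1)) ^ c₀ + K / (X + 1)) := by
  have hX0 : 0 < X := by linarith
  have hK0 : 0 ≤ K := by rw [hK]; exact div_nonneg (by positivity) (by linarith)
  have h1 : 1 - c₀ / X + k / X ^ 2 ≤ Real.exp (-(c₀ / X) + k / X ^ 2) := by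
    have := Real.add_one_le_exp (-(c₀ / X) + k / X ^ 2)
    linarith
  -- In this form the contraction factors telescope to `((L+1)/(X+1))^{c₀}`.
  have hexp : Real.exp (-(c₀ / X)) ≤ (X / (X + 1)) ^ c₀ := by
    have h2 : Real.exp (-(1 / X)) ≤ X / (X + 1) := by
      rw [Real.exp_neg, ← inv_div (X + 1) X]
      apply inv_anti₀ (by positivity)
      have := Real.add_one_le_exp (1 / X)
      rw [add_div, div_self hX0.ne']
      linarith
    calc Real.exp (-(c₀ / X)) = Real.exp (-(1 / X)) ^ c₀ := by
          rw [← Real.exp_mul]; ring_nf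
      _ ≤ _ := Real.rpow_le_rpow (Real.exp_pos _).le h2 (by linarith)
  have hmain : Real.exp (-(c₀ / X)) * (a * ((L + 1) / X) ^ c₀) ≤
      a * ((L + 1) / (X + 1)) ^ c₀ := by
    calc _ ≤ (X / (X + 1)) ^ c₀ * (a * ((L + 1) / X) ^ c₀) := by gcongr
      _ = a * ((X / (X + 1)) * ((L + 1) / X)) ^ c₀ := by
          rw [Real.mul_rpow (by positivity) (by positivity)]; ring
      _ = _ := by
          congr 2
          field_simp
  -- Contraction brings `K/X` down to `K/(X + c₀)`, leaving `K(c₀ - 1)/((X+1)(X+c₀))` for the new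
  -- noise. The `1.2` in `K` covers `(X+1)(X+c₀) ≤ 1.2 X²`.
  have hnoise : Real.exp (-(c₀ / X)) * (K / X) + V / X ^ 2 ≤ K / (X + 1) := by
    have h2 : Real.exp (-(c₀ / X)) ≤ X / (X + c₀) := by
      rw [Real.exp_neg, ← inv_div (X + c₀) X]
      apply inv_anti₀ (by positivity)
      have := Real.add_one_le_exp (c₀ / X)
      rw [add_div, div_self hX0.ne']
      linarith
    have h3 : Real.exp (-(c₀ / X)) * (K / X) ≤ K / (X + c₀) := by
      calc _ ≤ X / (X + c₀) * (K / X) := by gcongr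
        _ = _ := by field_simp
    have h4 : V / X ^ 2 ≤ K / (X + 1) - K / (X + c₀) := by
      have e : K / (X + 1) - K / (X + c₀) = 1.2 * V / ((X + 1) * (X + c₀)) := by
        rw [hK]
        have : c₀ - 1 ≠ 0 := by linarith
        field_simp
        ring
      rw [e, div_le_div_iff₀ (by positivity) (by positivity)]
      have h5 : (X + 1) * (X + c₀) ≤ 1.2 * X ^ 2 := by
        have : 100 * c₀ ≤ X := by linarith
        nlinarith
      calc V * ((X + 1) * (X + c₀)) ≤ V * (1.2 * X ^ 2) := by gcongr
        _ = _ := by ring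
    linarith
  have hw1 : 1 ≤ Real.exp (k * (1 / L - 1 / X)) := by
    apply Real.one_le_exp
    apply mul_nonneg hk
    rw [sub_nonneg]
    exact one_div_le_one_div_of_le hL (by linarith)
  set S := a * ((L + 1) / X) ^ c₀ + K / X with hS
  have hS0 : 0 ≤ S := by positivity
  calc (1 - c₀ / X + k / X ^ 2) * (Real.exp (k * (1 / L - 1 / (X - 1))) * S) + V / X ^ 2
      ≤ Real.exp (-(c₀ / X) + k / X ^ 2) * (Real.exp (k * (1 / L - 1 / (X - 1))) * S)
          + V / X ^ 2 := by gcongr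
    _ = (Real.exp (-(c₀ / X) + k / X ^ 2) * Real.exp (k * (1 / L - 1 / (X - 1)))) * S
          + V / X ^ 2 := by ring
    _ ≤ (Real.exp (-(c₀ / X)) * Real.exp (k * (1 / L - 1 / X))) * S
          + Real.exp (k * (1 / L - 1 / X)) * (V / X ^ 2) := by
        have h6 := one_add_mul_exp_le (L := L) (a := c₀ / X) hk (by linarith : 1 < X)
        have h7 : 0 ≤ V / X ^ 2 := by positivity
        have h8 := mul_le_mul_of_nonneg_right hw1 h7
        rw [one_mul] at h8
        gcongr
    _ = Real.exp (k * (1 / L - 1 / X)) * (Real.exp (-(c₀ / X)) * (a * ((L + 1) / X) ^ c₀) +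
          (Real.exp (-(c₀ / X)) * (K / X) + V / X ^ 2)) := by rw [hS]; ring
    _ ≤ _ := by gcongr

theorem exp_le_of_le {y : ℝ} (hy : y ≤ 0.3) : Real.exp y ≤ 1.43 := by
  have h1 : Real.exp y ≤ Real.exp 0.3 := Real.exp_le_exp.2 hy
  have h2 := Real.add_one_le_exp (-0.3 : ℝ)
  have h3 : Real.exp (-0.3) * Real.exp 0.3 = 1 := by rw [← Real.exp_add]; norm_num
  have h4 := Real.exp_pos 0.3
  nlinarith

/-- The decay of the transient term, with the sum in the base split into two powers. -/
theorem transient_le {L m a b p : ℝ} (hL : 3 ≤ L) (hm : 0 < m) (ha : 0 ≤ a) (hb : 0 ≤ b)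
    (hp : 1 ≤ p) (hab : L / m ≤ a + b) :
    2 * ((L + 1) / (L + m)) ^ (2 * p) ≤ a ^ p + b ^ p := by
  -- AM-GM `(L + m)² ≥ 4Lm`, with `(L + 1)² ≤ 2L²` from `L ≥ 3`.
  have h1 : ((L + 1) / (L + m)) ^ 2 ≤ (a + b) / 2 := by
    have : ((L + 1) / (L + m)) ^ 2 ≤ L / m / 2 := by
      rw [div_pow, div_div, div_le_div_iff₀ (by positivity) (by positivity)]
      nlinarith [mul_nonneg (by linarith : (0 : ℝ) ≤ L) (sq_nonneg (L - m)),
        mul_nonneg hm.le (mul_nonneg (by linarith : (0 : ℝ) ≤ L - 3) (by linarith : 0 ≤ L))]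
    linarith
  have h2 : ((L + 1) / (L + m)) ^ (2 * p) ≤ ((a + b) / 2) ^ p := by
    rw [Real.rpow_mul (by positivity)]
    apply Real.rpow_le_rpow (by positivity) _ (by linarith)
    simpa using h1
  have h3 := (convexOn_rpow hp).2 ha hb (by norm_num : (0 : ℝ) ≤ 1 / 2)
    (by norm_num : (0 : ℝ) ≤ 1 / 2) (by norm_num)
  simp only [smul_eq_mul] at h3
  have e : (1 / 2 * a + 1 / 2 * b : ℝ) = (a + b) / 2 := by ring
  rw [e] at h3
  linarith

/-- `1 / ε` is dominated by the constant `C₁`. -/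
theorem inv_level_le_constC₁ {d : ℕ} (hd : 2 ≤ d) {δ c l₁ L : ℝ} (hδ₀ : 0 < δ) (hδ₁ : δ < 1)
    (hL : 0 < L) :
    2.86 * (128 * Real.exp 1 * d / δ ^ 3) ≤ 4 * constC₁ d δ c l₁ L := by
  have hd' : (2 : ℝ) ≤ d := by exact_mod_cast hd
  have he := Real.exp_one_gt_d9
  have hQ : 5.4 ≤ Real.exp 1 * d := by nlinarith
  set z : ℝ := 4 * Real.exp 1 * d / δ ^ 2 with hz
  have hz0 : z * δ ^ 2 = 4 * (Real.exp 1 * d) := by rw [hz]; field_simp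
  have hδ2 : δ ^ 2 ≤ δ := by nlinarith
  have hzpos : 0 < z := by positivity
  have hzδ : 21.6 ≤ z * δ := by nlinarith
  have hz1 : 21.6 ≤ z := by nlinarith
  -- The exponent is about `3.6`, but the cube suffices: `1/ε` equals `32 z/δ`, and `z δ` is bounded
  -- below.
  have hpow : z ^ 3 ≤ z ^ (5 / (2 * Real.log 2)) := by
    rw [← Real.rpow_natCast]
    apply Real.rpow_le_rpow_of_exponent_le (by linarith)
    have h1 := Real.log_two_lt_d9
    have h2 := Real.log_two_gt_d9
    rw [le_div_iff₀ (by linarith)]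
    norm_num
    linarith
  have hC : 2 * z ^ 3 ≤ 4 * constC₁ d δ c l₁ L := by
    unfold constC₁
    rw [← hz]
    have h1 : 1 ≤ Real.exp (2 * c ^ 2 * l₁ ^ 2 / L) := Real.one_le_exp (by positivity)
    have h2 : 0 < z ^ (5 / (2 * Real.log 2)) := by positivity
    nlinarith
  refine le_trans ?_ hC
  have e : 128 * Real.exp 1 * d / δ ^ 3 = 32 * z / δ := by
    rw [hz]; field_simp; ring
  rw [e, mul_div_assoc', div_le_iff₀ hδ₀]
  have h3 : z * 21.6 ≤ z * (z * δ) := by gcongr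
  have h4 : z * (z * 21.6) ≤ z * (z * (z * δ)) := by gcongr
  nlinarith

end Constants

/-! ### Assembling the probability bound, the error bound and the rate. -/

section Main

/-- The event has probability at least `1/2`, so normalizing at most doubles the integral. -/
theorem integral_cond_le {Ω : Type*} [MeasurableSpace Ω] {Pr : Measure Ω} [IsProbabilityMeasure Pr]
    {f : Ω → ℝ} (hf : Measurable f) (hf0 : ∀ ω, 0 ≤ f ω) {E : Set Ω} {δ y : ℝ} (hδ : δ ≤ 1)
    (hE : MeasurableSet E) (hEc : Pr Eᶜ ≤ ENNReal.ofReal (δ / 2)) (hy0 : 0 ≤ y)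
    (hy : ∫⁻ ω in E, ENNReal.ofReal (f ω) ∂Pr ≤ ENNReal.ofReal y) :
    ∫ ω, f ω ∂(ProbabilityTheory.cond Pr E) ≤ 2 * y := by
  have hI : ∫ ω in E, f ω ∂Pr ≤ y := by
    rw [integral_eq_lintegral_of_nonneg_ae (.of_forall hf0) hf.aestronglyMeasurable]
    exact ENNReal.toReal_le_of_le_ofReal hy0 hy
  have hI0 : 0 ≤ ∫ ω in E, f ω ∂Pr := integral_nonneg hf0
  have hP : 1 / 2 ≤ (Pr E).toReal := by
    have h1 : (Pr Eᶜ).toReal ≤ δ / 2 ∨ (Pr Eᶜ).toReal ≤ 1 / 2 := by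
      by_cases h : 0 ≤ δ / 2
      · exact Or.inl (ENNReal.toReal_le_of_le_ofReal h hEc)
      · right
        rw [ENNReal.ofReal_of_nonpos (by linarith), nonpos_iff_eq_zero] at hEc
        rw [hEc]; norm_num
    have h2 := probReal_compl_eq_one_sub (μ := Pr) hE
    simp only [Measure.real] at h2
    rcases h1 with h1 | h1 <;> linarith
  have hc : ((Pr E)⁻¹).toReal ≤ 2 := by
    rw [ENNReal.toReal_inv]
    exact inv_le_of_inv_le₀ (by norm_num) (by linarith)
  rw [ProbabilityTheory.cond, integral_smul_measure, smul_eq_mul]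
  exact mul_le_mul hc hI hI0 (by norm_num)

variable {d N b μ : ℕ} {P : Measure (Vec d)} [IsProbabilityMeasure P] {r : ℝ}
  {Ω : Type*} [MeasurableSpace Ω] {Pr : Measure Ω} [IsProbabilityMeasure Pr]
  {v₀ : Ω → Vec d} {x : ℕ → Ω → Vec d} {sel : ℕ → Fin N → Fin b → ℕ} {q : Vec d} {γ : ℕ → ℝ}

/-- With step sizes `c / (L + t)`, the potential stays below `1 - ε` for ever with probability at
least `1 - δ / 2`, and on that event `tan²` of the angle to `q` decays. -/
theorem goodEvent_bounds (hd : 2 ≤ d) (hN : 0 < N) (hb : 0 < b)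
    (hbound : ∀ᵐ x ∂P, ‖x‖ ≤ r) (hgap : secondEig hd P < topEig hd P)
    (hq : ‖q‖ = 1) (hqeig : matOp (covMat P) q = topEig hd P • q)
    (hin : IsRandomInput P Pr v₀ x) (hsel : IsSplitter N b μ sel)
    {δ c₀ c L : ℝ} (hδ₀ : 0 < δ) (hδ₁ : δ < 1) (hc₀ : 2 < c₀) (hcpos : 0 < c)
    (hcg : 2 * c * (topEig hd P - secondEig hd P) = c₀) (hLc : 100 * c₀ ≤ L)
    (hγ : ∀ t, γ t = c / (L + t)) {ε : ℝ} (hεdef : ε = δ ^ 3 / (128 * Real.exp 1 * d))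
    (hsmall : (10 * (c / L) * r ^ 2) ^ 2 ≤ ε)
    (hk : (6 * topEig hd P ^ 2 + 8 * batchVar P N b / ε) * c ^ 2 / L ≤ 0.3) (t : ℕ) :
    Pr (goodEvent (Psi q γ v₀ x sel) ε (t + 1))ᶜ ≤ ENNReal.ofReal (δ / 2) ∧
    ∫⁻ ω in goodEvent (Psi q γ v₀ x sel) ε (t + 1),
      tanSq q (dmk γ (v₀ ω) (batches x sel ω) (t + 1)) ∂Pr ≤
        ENNReal.ofReal (1.43 * (1 / ε * ((L + 1) / (L + (t + 2))) ^ c₀ +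
          (2.4 * c ^ 2 * batchVar P N b / (c₀ - 1)) / (L + (t + 2)))) := by
  have hd' : (2 : ℝ) ≤ d := by exact_mod_cast hd
  have he := Real.exp_one_gt_d9
  have hQ : 5.4 ≤ Real.exp 1 * d := by nlinarith
  have hV := batchVar_nonneg P N b
  have hε : 0 < ε := by rw [hεdef]; positivity
  have hLpos : 0 < L := by linarith
  have hδ3 : δ ^ 3 ≤ 1 := pow_le_one₀ hδ₀.le hδ₁.le
  have hε1 : ε ≤ 1 := by
    rw [hεdef, div_le_one (by positivity)]; linarith
  obtain ⟨g, hg⟩ : ∃ g, g = topEig hd P - secondEig hd P := ⟨_, rfl⟩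
  obtain ⟨V, hVdef⟩ : ∃ V, V = batchVar P N b := ⟨_, rfl⟩
  -- The coefficient `8 = 6 + 2` also absorbs the additive noise `2γ²V`, because `ε ≤ 1`.
  obtain ⟨k, hkdef⟩ : ∃ k, k = (6 * topEig hd P ^ 2 + 8 * V / ε) * c ^ 2 := ⟨_, rfl⟩
  rw [← hVdef] at hV hk ⊢
  rw [← hg] at hcg
  rw [← hkdef] at hk
  have hk0 : 0 ≤ k := by rw [hkdef]; positivity
  have hγs : ∀ t : ℕ, γ (t + 1) = c / (L + t + 1) := fun t => by
    rw [hγ]; push_cast; ring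
  have hX : ∀ t : ℕ, 0 < L + t + 1 := fun t => by positivity
  have hγ0 : ∀ t, 0 ≤ γ (t + 1) := fun t => by rw [hγs]; have := hX t; positivity
  have hγle : ∀ t, γ (t + 1) ≤ c / L := fun t => by
    rw [hγs]
    apply div_le_div_of_nonneg_left hcpos.le hLpos
    have : (0 : ℝ) ≤ t := t.cast_nonneg
    linarith
  have hsm : ∀ t, (10 * γ (t + 1) * r ^ 2) ^ 2 ≤ ε := fun t => by
    refine le_trans ?_ hsmall
    have := hγ0 t
    have := hγle t
    gcongr
  have hgγeq : ∀ t : ℕ, 2 * γ (t + 1) * g = c₀ / (L + t + 1) := fun t => by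
    rw [hγs, ← hcg]; ring
  have hgγ : ∀ t, 2 * γ (t + 1) * (topEig hd P - secondEig hd P) ≤ 1 := fun t => by
    rw [← hg, hgγeq, div_le_one (hX t)]
    have : (0 : ℝ) ≤ t := t.cast_nonneg
    linarith
  have hκ : ∀ t : ℕ, γ (t + 1) ^ 2 * (6 * topEig hd P ^ 2 + 6 * V / ε) ≤ k / (L + t + 1) ^ 2 ∧
      γ (t + 1) ^ 2 * (6 * topEig hd P ^ 2 + 6 * V / ε) + 2 * γ (t + 1) ^ 2 * V ≤
        k / (L + t + 1) ^ 2 := fun t => by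
    have e : k / (L + t + 1) ^ 2 = γ (t + 1) ^ 2 * (6 * topEig hd P ^ 2 + 8 * V / ε) := by
      rw [hkdef, hγs, div_pow]; ring
    have h1 : V ≤ V / ε := by rw [le_div_iff₀ hε]; nlinarith
    have e6 : 6 * V / ε = 6 * (V / ε) := by ring
    have e8 : 8 * V / ε = 8 * (V / ε) := by ring
    rw [e, e6, e8]
    have h2 := mul_le_mul_of_nonneg_left h1 (sq_nonneg (γ (t + 1)))
    have h3 : 0 ≤ γ (t + 1) ^ 2 * V := by positivity
    constructor <;> linarith
  have hweight : ∀ t : ℕ, Real.exp (k * (1 / L - 1 / (L + t))) ≤ 1.43 := fun t => by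
    apply exp_le_of_le
    refine le_trans ?_ hk
    have h1 : 0 ≤ k * (1 / (L + t)) := by positivity
    have e : k / L = k * (1 / L) := by ring
    rw [e]; linarith
  constructor
  -- Chosen so that `√(e d η) = δ/4`; then `ε = η δ/8`, and the exit probability is at most `1.43
  -- δ/8 ≤ δ/4`.
  · set η : ℝ := δ ^ 2 / (16 * Real.exp 1 * d) with hη
    have hη0 : 0 < η := by positivity
    have hεη : ε = η * (δ / 8) := by rw [hεdef, hη]; field_simp; ring
    let w : ℕ → ℝ := fun t => Real.exp (k * (1 / L - 1 / (L + t))) * (1 / η)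
    have hmax := measure_diff_goodEvent_le hd hN hb hbound hgap hq hqeig hin hsel hε
      (by rw [hεη]; nlinarith : ε ≤ η) hγ0 hsm hgγ (w := w) (by simp [w]) (fun t => by
        have hX1 : 1 < L + t + 1 := by
          have : (0 : ℝ) ≤ t := t.cast_nonneg
          linarith
        have h1 := one_add_mul_exp_le (L := L) (a := 0) hk0 hX1
        have h2 := Real.add_one_le_exp (-0 + k / (L + t + 1) ^ 2)
        have h3 := (hκ t).2
        rw [hVdef] at h3
        simp only [w]
        push_cast
        rw [← mul_assoc, ← add_assoc]
        apply mul_le_mul_of_nonneg_right _ (by positivity)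
        rw [neg_zero, Real.exp_zero, one_mul, add_sub_cancel_right] at h1
        refine le_trans (mul_le_mul_of_nonneg_right ?_ (Real.exp_pos _).le) h1
        rw [neg_zero] at h2
        linarith) t
    have hinit := measure_init_le (sel := sel) (γ := γ) hd hq hin hη0
    have hsqrt : √(Real.exp 1 * d * η) = δ / 4 := by
      rw [show Real.exp 1 * d * η = (δ / 4) ^ 2 by rw [hη]; field_simp; ring]
      exact Real.sqrt_sq (by positivity)
    rw [hsqrt] at hinit
    have hw : ε * w t ≤ δ / 4 := by
      have h1 := hweight t
      have e : ε * w t = Real.exp (k * (1 / L - 1 / (L + t))) * (δ / 8) := by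
        simp only [w]; rw [hεη]; field_simp
      rw [e]
      nlinarith
    set G : Set Ω := {ω | Psi q γ v₀ x sel 0 ω ≤ 1 - η}
    calc Pr (goodEvent (Psi q γ v₀ x sel) ε (t + 1))ᶜ
        ≤ Pr (Gᶜ ∪ (G \ goodEvent (Psi q γ v₀ x sel) ε (t + 1))) := by
          refine measure_mono fun ω hω => ?_
          by_cases h : ω ∈ G
          · exact Or.inr ⟨h, hω⟩
          · exact Or.inl h
      _ ≤ ENNReal.ofReal (δ / 4) + ENNReal.ofReal (δ / 4) :=
          (measure_union_le _ _).trans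
            (add_le_add hinit (hmax.trans (ENNReal.ofReal_le_ofReal hw)))
      _ = _ := by
          rw [← ENNReal.ofReal_add (by positivity) (by positivity)]
          ring_nf
  · set K : ℝ := 2.4 * c ^ 2 * V / (c₀ - 1) with hK
    have hK0 : 0 ≤ K := div_nonneg (by positivity) (by linarith)
    let y : ℕ → ℝ := fun t => Real.exp (k * (1 / L - 1 / (L + t))) *
      (1 / ε * ((L + 1) / (L + t + 1)) ^ c₀ + K / (L + t + 1))
    have hy0 : ∀ t, 0 ≤ y t := fun t => by
      have := hX t
      positivity
    have h := (setLIntegral_tanSq_le hd hN hb hbound hgap hq hqeig hin hsel hε hγ0 hsm hgγ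
      (u := y) (by
        simp only [y, Nat.cast_zero, add_zero, sub_self, mul_zero, Real.exp_zero, one_mul]
        rw [div_self (by linarith), Real.one_rpow, mul_one]
        have : 0 ≤ K / (L + 1) := by positivity
        linarith) hy0 (fun t => by
        have hLX : L + 1 ≤ L + t + 1 := by
          have : (0 : ℝ) ≤ t := t.cast_nonneg
          linarith
        have h1 := explicit_recursion (a := 1 / ε) (V := 2 * c ^ 2 * V) (K := K) hk0 hLpos hLX hc₀
          hLc (by positivity) (by positivity) (by rw [hK]; ring)
        rw [add_sub_cancel_right] at h1
        have h2 := (hκ t).1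
        have e2 : 2 * γ (t + 1) ^ 2 * V = 2 * c ^ 2 * V / (L + t + 1) ^ 2 := by
          rw [hγs, div_pow]; ring
        rw [← hg, ← hVdef, e2, hgγeq]
        have h3 : (1 - c₀ / (L + t + 1) + γ (t + 1) ^ 2 * (6 * topEig hd P ^ 2 + 6 * V / ε)) * y t ≤
            (1 - c₀ / (L + t + 1) + k / (L + t + 1) ^ 2) * y t :=
          mul_le_mul_of_nonneg_right (by linarith) (hy0 t)
        have e4 : y (t + 1) = Real.exp (k * (1 / L - 1 / (L + t + 1))) *
            (1 / ε * ((L + 1) / (L + t + 1 + 1)) ^ c₀ + K / (L + t + 1 + 1)) := by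
          simp only [y]; push_cast; simp only [← add_assoc]
        rw [e4]
        simp only [y] at h3 ⊢
        linarith) t).2
    refine h.trans (ENNReal.ofReal_le_ofReal ?_)
    have e : L + (t + 2 : ℝ) = L + ((t + 1 : ℕ) : ℝ) + 1 := by push_cast; ring
    rw [e]
    have := hX (t + 1)
    simp only [y]
    apply mul_le_mul_of_nonneg_right (hweight (t + 1))
    positivity

/-- The error bound in terms of the number of samples. -/
theorem error_bound {d : ℕ} (hd : 2 ≤ d) {δ c₀ c l₁ L₁ L₂ L V s B n T t y : ℝ} (hδ₀ : 0 < δ)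
    (hδ₁ : δ < 1) (hc₀ : 2 < c₀) (hLc : 100 * c₀ ≤ L₁) (hL₂ : 0 < L₂)
    (hL : L = L₁ + V * L₂) (hV : 0 ≤ V) (hB : 0 < B) (hVs : V = s / B) (hn : 0 < n) (hT : 0 < T)
    (ht : 0 ≤ t) (hTt : T ≤ (t + 2) * n)
    (hy : y ≤ 2 * (1.43 * (1 / (δ ^ 3 / (128 * Real.exp 1 * d)) * ((L + 1) / (L + (t + 2))) ^ c₀ +
      (2.4 * c ^ 2 * V / (c₀ - 1)) / (L + (t + 2))))) :
    y ≤ c₀ * constC₁ d δ c l₁ L * (n * L₁ / T) ^ (c₀ / 2) +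
      c₀ * constC₁ d δ c l₁ L * (n * s * L₂ / (B * T)) ^ (c₀ / 2) +
      constC₂ c₀ c l₁ L * s * n / (B * T) := by
  have hVL : 0 ≤ V * L₂ := by positivity
  have hLpos : 200 ≤ L := by linarith
  have hL₁pos : 0 < L₁ := by linarith
  have hs : s = V * B := by rw [hVs]; field_simp
  have hs0 : 0 ≤ s := by rw [hs]; positivity
  have hm : 0 < t + 2 := by linarith
  -- There are `t + 1 = ⌊T/n⌋` iterations; the `t + 2` in the supersolution makes up for the
  -- rounding.
  have hnT : 1 / (t + 2) ≤ n / T := by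
    rw [div_le_div_iff₀ hm hT]; linarith
  have e1 : n * s * L₂ / (B * T) = n * (V * L₂) / T := by
    rw [hs]; field_simp
  have e2 : constC₂ c₀ c l₁ L * s * n / (B * T) = constC₂ c₀ c l₁ L * V * (n / T) := by
    rw [hs]; field_simp
  have htr := transient_le (L := L) (m := t + 2) (a := n * L₁ / T) (b := n * (V * L₂) / T)
    (p := c₀ / 2) (by linarith) hm (by positivity) (by positivity) (by linarith) (by
      have h1 := mul_le_mul_of_nonneg_left hnT (by linarith : 0 ≤ L)
      calc L / (t + 2) = L * (1 / (t + 2)) := by ring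
        _ ≤ L * (n / T) := h1
        _ = _ := by rw [hL]; ring)
  rw [show 2 * (c₀ / 2) = c₀ by ring] at htr
  have hC₁ := inv_level_le_constC₁ (c := c) (l₁ := l₁) hd hδ₀ hδ₁ (by linarith : 0 < L)
  have hC₁0 : 0 ≤ constC₁ d δ c l₁ L := by unfold constC₁; positivity
  have hC₂ : 8 * c ^ 2 / (c₀ - 2) ≤ constC₂ c₀ c l₁ L := by
    unfold constC₂
    apply div_le_div_of_nonneg_right _ (by linarith)
    apply le_mul_of_one_le_right (by positivity)
    apply Real.one_le_exp
    positivity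
  rw [e1, e2]
  set A := ((L + 1) / (L + (t + 2))) ^ c₀ with hA
  have hA0 : 0 ≤ A := by positivity
  have part1 : 2.86 * (128 * Real.exp 1 * d / δ ^ 3) * A ≤
      c₀ * constC₁ d δ c l₁ L * ((n * L₁ / T) ^ (c₀ / 2) + (n * (V * L₂) / T) ^ (c₀ / 2)) := by
    calc _ ≤ 4 * constC₁ d δ c l₁ L * A := by gcongr
      _ = 2 * constC₁ d δ c l₁ L * (2 * A) := by ring
      _ ≤ c₀ * constC₁ d δ c l₁ L *
          ((n * L₁ / T) ^ (c₀ / 2) + (n * (V * L₂) / T) ^ (c₀ / 2)) := by gcongr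
  have part2 : 2.86 * ((2.4 * c ^ 2 * V / (c₀ - 1)) / (L + (t + 2))) ≤
      constC₂ c₀ c l₁ L * V * (n / T) := by
    -- Here `2.86 = 2 · 1.43`: conditioning times the bound on the weights.
    have h1 : 2.86 * (2.4 * c ^ 2 / (c₀ - 1)) ≤ 8 * c ^ 2 / (c₀ - 2) := by
      rw [mul_div_assoc', div_le_div_iff₀ (by linarith) (by linarith)]
      nlinarith [mul_nonneg (sq_nonneg c) (by linarith : 0 ≤ c₀ - 2), sq_nonneg c]
    have h2 : 1 / (L + (t + 2)) ≤ n / T :=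
      (one_div_le_one_div_of_le hm (by linarith)).trans hnT
    calc _ = 2.86 * (2.4 * c ^ 2 / (c₀ - 1)) * V * (1 / (L + (t + 2))) := by ring
      _ ≤ constC₂ c₀ c l₁ L * V * (n / T) := by
        have h3 := h1.trans hC₂
        have h4 : 0 ≤ 8 * c ^ 2 / (c₀ - 2) := div_nonneg (by positivity) (by linarith)
        have h5 := h4.trans hC₂
        gcongr
  have e3 : 1 / (δ ^ 3 / (128 * Real.exp 1 * d)) = 128 * Real.exp 1 * d / δ ^ 3 := one_div_div _ _
  rw [e3] at hy
  linarith

/-- Used to replace `L`, which depends on the batch size, by `L₁'` in the rate. -/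
theorem constC₁_anti {d : ℕ} {δ c l₁ L L' : ℝ} (hL : 0 < L) (hLL : L ≤ L') :
    constC₁ d δ c l₁ L' ≤ constC₁ d δ c l₁ L := by
  unfold constC₁
  gcongr

theorem constC₂_anti {c₀ c l₁ L L' : ℝ} (hc₀ : 2 < c₀) (hL : 0 < L) (hLL : L ≤ L') :
    constC₂ c₀ c l₁ L' ≤ constC₂ c₀ c l₁ L := by
  unfold constC₂
  apply div_le_div_of_nonneg_right _ (by linarith)
  gcongr

/-- The bound `O(1/T)` that follows from the error bound. -/
theorem rate_bound {d : ℕ} {δ c₀ c l₁ L₁ L₂ L s B m κ T : ℝ} (hc₀ : 2 < c₀)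
    (hL₁ : 0 < L₁) (hL₂ : 0 < L₂) (hLL : L₁ ≤ L) (hδ : 0 < δ) (hs : 0 ≤ s) (hB : 1 ≤ B)
    (hm : 0 ≤ m) (hT : 0 < T) (hκ : m ≤ κ * B) (hBT : B + m ≤ T ^ (1 - 2 / c₀)) :
    c₀ * constC₁ d δ c l₁ L * ((B + m) * L₁ / T) ^ (c₀ / 2) +
      c₀ * constC₁ d δ c l₁ L * ((B + m) * s * L₂ / (B * T)) ^ (c₀ / 2) +
      constC₂ c₀ c l₁ L * s * (B + m) / (B * T) ≤
    (c₀ * constC₁ d δ c l₁ L₁ * L₁ ^ (c₀ / 2) +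
      c₀ * constC₁ d δ c l₁ L₁ * (s * L₂) ^ (c₀ / 2) +
      constC₂ c₀ c l₁ L₁ * s * (1 + κ)) / T := by
  have hB0 : 0 < B := by linarith
  have hC₁ := constC₁_anti (d := d) (δ := δ) (c := c) (l₁ := l₁) hL₁ hLL
  have hC₂ := constC₂_anti (c := c) (l₁ := l₁) hc₀ hL₁ hLL
  have hC₁0 : 0 ≤ constC₁ d δ c l₁ L := by unfold constC₁; positivity
  have hC₂0 : 0 ≤ constC₂ c₀ c l₁ L := by
    unfold constC₂; exact div_nonneg (by positivity) (by linarith)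
  -- The condition on `B + μ` says exactly that `(B + μ)/T ≤ T^{-2/c₀}`.
  have hratio : ((B + m) / T) ^ (c₀ / 2) ≤ 1 / T := by
    have h1 : (B + m) / T ≤ T ^ (-(2 / c₀)) := by
      rw [div_le_iff₀ hT]
      calc B + m ≤ T ^ (1 - 2 / c₀) := hBT
        _ = T ^ (-(2 / c₀)) * T := by
          rw [show (1 : ℝ) - 2 / c₀ = -(2 / c₀) + 1 by ring, Real.rpow_add hT, Real.rpow_one]
    calc ((B + m) / T) ^ (c₀ / 2) ≤ (T ^ (-(2 / c₀))) ^ (c₀ / 2) :=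
          Real.rpow_le_rpow (by positivity) h1 (by linarith)
      _ = 1 / T := by
          rw [← Real.rpow_mul hT.le, show -(2 / c₀) * (c₀ / 2) = -1 by field_simp,
            Real.rpow_neg_one, one_div]
  have hp : 0 ≤ c₀ / 2 := by linarith
  have t1 : ((B + m) * L₁ / T) ^ (c₀ / 2) ≤ L₁ ^ (c₀ / 2) * (1 / T) := by
    rw [show (B + m) * L₁ / T = L₁ * ((B + m) / T) by ring,
      Real.mul_rpow hL₁.le (by positivity)]
    gcongr
  have t2 : ((B + m) * s * L₂ / (B * T)) ^ (c₀ / 2) ≤ (s * L₂) ^ (c₀ / 2) * (1 / T) := by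
    calc ((B + m) * s * L₂ / (B * T)) ^ (c₀ / 2) ≤ ((s * L₂) * ((B + m) / T)) ^ (c₀ / 2) := by
          apply Real.rpow_le_rpow (by positivity) _ hp
          rw [show s * L₂ * ((B + m) / T) = (B + m) * s * L₂ / T by ring]
          apply div_le_div_of_nonneg_left (by positivity) hT
          exact le_mul_of_one_le_left hT.le hB
      _ = (s * L₂) ^ (c₀ / 2) * ((B + m) / T) ^ (c₀ / 2) :=
          Real.mul_rpow (by positivity) (by positivity)
      _ ≤ _ := by gcongr
  have t3 : s * (B + m) / (B * T) ≤ s * (1 + κ) * (1 / T) := by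
    rw [mul_one_div, div_le_div_iff₀ (by positivity) hT]
    have h1 : B + m ≤ (1 + κ) * B := by linarith
    calc s * (B + m) * T ≤ s * ((1 + κ) * B) * T := by gcongr
      _ = _ := by ring
  have t3' : 0 ≤ s * (B + m) / (B * T) := by positivity
  calc _ = c₀ * constC₁ d δ c l₁ L * ((B + m) * L₁ / T) ^ (c₀ / 2) +
      c₀ * constC₁ d δ c l₁ L * ((B + m) * s * L₂ / (B * T)) ^ (c₀ / 2) +
      constC₂ c₀ c l₁ L * (s * (B + m) / (B * T)) := by ring
    _ ≤ c₀ * constC₁ d δ c l₁ L₁ * (L₁ ^ (c₀ / 2) * (1 / T)) +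
      c₀ * constC₁ d δ c l₁ L₁ * ((s * L₂) ^ (c₀ / 2) * (1 / T)) +
      constC₂ c₀ c l₁ L₁ * (s * (1 + κ) * (1 / T)) := by
        have := hC₁0.trans hC₁
        have := hC₂0.trans hC₂
        gcongr
    _ = _ := by ring

theorem nestedSpace_one {Ω : Type*} (Ψ : ℕ → Ω → ℝ) (ε : ℝ) (t : ℕ) :
    nestedSpace (J := 0) Ψ (fun _ => 0) (fun _ => ε) t = goodEvent Ψ ε t := by
  ext ω
  simp [nestedSpace, goodEvent]

end Main

theorem corollary2 (d : ℕ) (hd : 2 ≤ d)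
    -- the law of the samples: zero mean, bounded by `r ≥ 1`, with a spectral gap
    (P : Measure (Vec d)) [IsProbabilityMeasure P] (r : ℝ) (hr : 1 ≤ r)
    (hmean : ∫ x, x ∂P = 0) (hbound : ∀ᵐ x ∂P, ‖x‖ ≤ r)
    (hgap : secondEig hd P < topEig hd P)
    -- the unit top eigenvector
    (q : Vec d) (hq : ‖q‖ = 1)
    (hqeig : (covMat P).mulVec (fun i => q i) = topEig hd P • fun i => q i)
    -- the parameters
    (δ : ℝ) (hδ₀ : 0 < δ) (hδ₁ : δ < 1) (c₀ c : ℝ) (hc₀ : 2 < c₀)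
    (hc : c = c₀ / (2 * (topEig hd P - secondEig hd P)))
    (L₁' L₂' : ℝ) (hL₁ : boundL₁ d r c δ ≤ L₁') (hL₂ : boundL₂ d c δ ≤ L₂') :
    ∃ K : ℝ → ℝ, ∀ (Ω : Type u) [MeasurableSpace Ω] (Pr : Measure Ω) [IsProbabilityMeasure Pr]
      (v₀ : Ω → Vec d) (x : ℕ → Ω → Vec d), IsRandomInput P Pr v₀ x →
      ∀ (N b μ : ℕ) (sel : ℕ → Fin N → Fin b → ℕ), 0 < N → 0 < b → IsSplitter N b μ sel →
      ∀ (B : ℕ) (L : ℝ) (γ : ℕ → ℝ), B = N * b → L = L₁' + batchVar P N b * L₂' →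
      (∀ t, γ t = c / (L + t)) →
      ∃ (J : ℕ) (τ : Fin (J + 1) → ℕ) (ε : Fin (J + 1) → ℝ) (Ω' : ℕ → Set Ω),
        IsSchedule τ ε ∧
        (∀ t, Ω' t = nestedSpace (Psi q γ v₀ x sel) τ ε t) ∧
        (∀ t, Ω' (t + 1) ⊆ Ω' t) ∧
        (∀ t, MeasurableSet[sigmaAlg v₀ x sel t] (Ω' (t + 1))) ∧
        ENNReal.ofReal (1 - δ) ≤ Pr (⋂ t : ℕ, ⋂ _ : 0 < t, Ω' t) ∧
        ∀ T : ℕ, B + μ ≤ T →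
          -- the error after the `T / (B + μ)` iterations that `T` samples allow
          (∫ ω, Psi q γ v₀ x sel (T / (B + μ)) ω ∂(ProbabilityTheory.cond Pr (Ω' (T / (B + μ))))
            ≤ c₀ * constC₁ d δ c (topEig hd P) L
                * (((B : ℝ) + μ) * L₁' / T) ^ (c₀ / 2)
              + c₀ * constC₁ d δ c (topEig hd P) L
                * (((B : ℝ) + μ) * sampleVar P * L₂' / (B * T)) ^ (c₀ / 2)
              + constC₂ c₀ c (topEig hd P) L * sampleVar P * ((B : ℝ) + μ) / (B * T)) ∧
          -- the rate `O(1/T)`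
          (∀ κ : ℝ, (μ : ℝ) ≤ κ * B → (B : ℝ) + μ ≤ (T : ℝ) ^ (1 - 2 / c₀) →
            ∫ ω, Psi q γ v₀ x sel (T / (B + μ)) ω ∂(ProbabilityTheory.cond Pr (Ω' (T / (B + μ))))
              ≤ K κ / T) 
 := by
  have hqop : matOp (covMat P) q = topEig hd P • q := by
    rw [Matrix.toLpLin_apply, hqeig]
    rfl
  have hgap' : 0 < topEig hd P - secondEig hd P := by linarith
  have hl₂ : 0 ≤ secondEig hd P := covEig_nonneg hbound _
  have hd' : (2 : ℝ) ≤ d := by exact_mod_cast hd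
  have hcg : 2 * c * (topEig hd P - secondEig hd P) = c₀ := by rw [hc]; field_simp
  -- Evaluated at `L₁'` rather than `L`, so that the constant is fixed before `N`, `b`, `μ` and `T`.
  refine ⟨fun κ => c₀ * constC₁ d δ c (topEig hd P) L₁' * L₁' ^ (c₀ / 2) +
      c₀ * constC₁ d δ c (topEig hd P) L₁' * (sampleVar P * L₂') ^ (c₀ / 2) +
      constC₂ c₀ c (topEig hd P) L₁' * sampleVar P * (1 + κ), ?_⟩
  intro Ω _ Pr _ v₀ x hin N b μ sel hN hb hsel B L γ hB hL hγ
  have hV := batchVar_nonneg P N b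
  obtain ⟨hcpos, hL₂pos, hLc, hsmall, hk⟩ := step_constants (l₁ := topEig hd P) hd' hr hδ₀ hδ₁ hc₀ hgap'
    (by linarith) (covEig_le hbound _) hc hL₁ hL₂ hV
  have hVL : 0 ≤ batchVar P N b * L₂' := by positivity
  rw [← hL] at hsmall hk
  have hLL : L₁' ≤ L := by linarith
  obtain ⟨ε, hε⟩ : ∃ ε, ε = δ ^ 3 / (128 * Real.exp 1 * d) := ⟨_, rfl⟩
  rw [← hε] at hsmall hk
  have hε0 : 0 < ε := by rw [hε]; positivity
  have hgood := goodEvent_bounds hd hN hb hbound hgap hq hqop hin hsel hδ₀ hδ₁ hc₀ hcpos hcg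
    (by linarith : 100 * c₀ ≤ L) hγ hε hsmall hk
  have hEm : ∀ t, MeasurableSet (goodEvent (Psi q γ v₀ x sel) ε t) :=
    measurableSet_goodEvent (measurable_Psi hin) ε
  have hBpos : 1 ≤ B := by rw [hB]; exact Nat.mul_pos hN hb
  have hVs : batchVar P N b = sampleVar P / (B : ℝ) := by
    rw [hB]; exact batchVar_eq hN hb hbound
  refine ⟨0, fun _ => 0, fun _ => ε, goodEvent (Psi q γ v₀ x sel) ε,
    ⟨rfl, fun i j hij => absurd hij (by omega), hε0, fun i j hij => absurd hij (by omega)⟩,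
    fun t => (nestedSpace_one _ _ _).symm, goodEvent_succ_subset _ _, fun t => ?_, ?_,
    fun T hT => ?_⟩
  · rw [← nestedSpace_one]
    exact measurableSet_sigmaAlg_nestedSpace q γ _ _ t
  · have hcompl : (⋂ t : ℕ, ⋂ _ : 0 < t, goodEvent (Psi q γ v₀ x sel) ε t)ᶜ =
        ⋃ t : ℕ, (goodEvent (Psi q γ v₀ x sel) ε (t + 1))ᶜ := by
      ext ω
      simp only [Set.mem_compl_iff, Set.mem_iInter, Set.mem_iUnion, not_forall]
      constructor
      · rintro ⟨t, ht, h⟩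
        exact ⟨t - 1, by rwa [Nat.sub_add_cancel ht]⟩
      · rintro ⟨t, h⟩
        exact ⟨t + 1, Nat.succ_pos t, h⟩
    have hm : Monotone fun t : ℕ => (goodEvent (Psi q γ v₀ x sel) ε (t + 1))ᶜ :=
      monotone_nat_of_le_succ fun t =>
        Set.compl_subset_compl.2 (goodEvent_succ_subset _ _ _)
    -- The complements increase, so the uniform bound at each finite time passes to the union.
    have hle : Pr (⋂ t : ℕ, ⋂ _ : 0 < t, goodEvent (Psi q γ v₀ x sel) ε t)ᶜ ≤
        ENNReal.ofReal δ := by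
      rw [hcompl, hm.measure_iUnion]
      exact iSup_le fun t => (hgood t).1.trans (ENNReal.ofReal_le_ofReal (by linarith))
    have hSm : MeasurableSet (⋂ t : ℕ, ⋂ _ : 0 < t, goodEvent (Psi q γ v₀ x sel) ε t) :=
      MeasurableSet.iInter fun t => MeasurableSet.iInter fun _ => hEm t
    rw [ENNReal.ofReal_sub _ hδ₀.le, ENNReal.ofReal_one, tsub_le_iff_right,
      ← prob_add_prob_compl (μ := Pr) hSm]
    gcongr
  · have hBμ : 0 < B + μ := by omega
    obtain ⟨t, ht⟩ : ∃ t, T / (B + μ) = t + 1 :=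
      Nat.exists_eq_succ_of_ne_zero (Nat.div_pos hT hBμ).ne'
    have hT0 : (0 : ℝ) < T := by exact_mod_cast hBμ.trans_le hT
    have hTt : (T : ℝ) ≤ ((t : ℝ) + 2) * ((B : ℝ) + μ) := by
      have h1 := Nat.lt_div_mul_add hBμ (a := T)
      rw [ht] at h1
      have h2 : T ≤ (t + 2) * (B + μ) := by nlinarith
      exact_mod_cast h2
    have hB1 : (1 : ℝ) ≤ B := by exact_mod_cast hBpos
    have hμ0 : (0 : ℝ) ≤ μ := μ.cast_nonneg
    have hL200 : 200 ≤ L := by linarith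
    -- The event at time `t + 1` restricts only the potentials up to `t`; the potential at `t + 1`
    -- is one free step beyond it, as in the second half of `goodEvent_bounds`.
    have hcond := integral_cond_le (measurable_Psi (sel := sel) (q := q) (γ := γ) hin (t + 1))
      (fun ω => potential_nonneg hq _) hδ₁.le (hEm (t + 1)) (hgood t).1 (by
        have : 0 ≤ 2.4 * c ^ 2 * batchVar P N b / (c₀ - 1) :=
          div_nonneg (by positivity) (by linarith)
        positivity)
      (le_trans (lintegral_mono fun ω => ofReal_potential_le_tanSq hq _) (hgood t).2)
    have hlevel : 1 / ε = 1 / (δ ^ 3 / (128 * Real.exp 1 * d)) := by rw [hε]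
    rw [hlevel] at hcond
    have hfirst := error_bound (l₁ := topEig hd P) (s := sampleVar P) (B := B)
      (n := (B : ℝ) + μ) (T := T) (t := t) hd hδ₀ hδ₁ hc₀ hLc hL₂pos hL hV (by linarith) hVs
      (by linarith) hT0 t.cast_nonneg hTt hcond
    rw [ht]
    exact ⟨hfirst, fun κ hκ hBT => hfirst.trans (rate_bound hc₀ (by linarith) hL₂pos hLL hδ₀
      (sampleVar_nonneg P) hB1 hμ0 hT0 hκ hBT)⟩
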